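/- Let $\mathcal K$ be a complex Hilbert space, $\mathcal H=\ell^2(\mathbb Z;\mathcal K)$, $\mathbb T=\mathbb R/2\pi\mathbb Z$ (represented by $[0,2\pi)$), and let $\mathcal F:\mathcal H\to L^2(\mathbb T;\mathcal K)$, $(\mathcal F\psi)(p)=\frac1{\sqrt{2\pi}}\sum_{k\in\mathbb Z}\psi_ke^{ikp}$, be the unitary Fourier transform. Let $X$ be the selfadjoint position operator $(X\psi)_k=k\psi_k$ on its maximal domain in $\mathcal H$. For a selfadjoint operator $A$ on $\mathcal H$ and a density matrix $\rho$ (a positive trace-class operator with $\operatorname{tr}\rho=1$) put $F_A^\rho(x)=\operatorname{tr}\big(\rho\,\mathbf 1_{(-\infty,x]}(A)\big)$, $x\in\mathbb R$. For cumulative distribution functions $F,G$ let $$L(F,G)=\sup_{x\in\mathbb R}\inf\{\epsilon>0:\ F(x-\epsilon)-\epsilon\le G(x)\le F(x+\epsilon)+\epsilon\}$$ be the Lévy distance. Let $W$ be a unitary operator on $\mathcal H$ that commutes with the right shift $(T\psi)_k=\psi_{k-1}$, with fibres $\widehat W:\mathbb T\to\mathcal U(\mathcal K)$, i.e. $(\mathcal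 FW\psi)(p)=\widehat W(p)(\mathcal F\psi)(p)$ for all $\psi\in\mathcal H$ and almost every $p$. Assume that there are a finite or countable index set $\mathcal I$, functions $\omega_k\in C^2(\mathbb R;\mathbb R)$ and $\Pi_k\in C^1(\mathbb R;\mathcal B(\mathcal K))$, $k\in\mathcal I$, such that for every $p\in\mathbb R$ the $\Pi_k(p)$ are mutually orthogonal orthogonal projections and $$\widehat W(p)=\sum_{k\in\mathcal I}e^{i\omega_k(p)}\Pi_k(p)\quad\text{(strongly)},$$ where $\widehat W$ is regarded as a $2\pi$-periodic function on $\mathbb R$, and such that $$\sum_{k\in\mathcal I}\sup_{p\in\mathbb R}\|\Pi_k'(p)\|<\infty,\qquad \sup_{k\in\mathcal I,\,p\in\mathbb R}|\omega_k''(p)|<\infty .$$ (Functions $\omega_k\in C^2(\mathbb T;\mathbb R)$ and $\Pi_k\in C^1(\mathbb T;\mathcal B(\mathcal K))$ are the case in which all $\omega_k$ and $\Pi_k$ are $2\pi$-periodic; the individual periodicity is not needed.) Let $V$ be the selfadjoint velocity operator on its maximal domain, $$(\mathcal FV\mathcal F^*f)(p)=\sum_{k\in\mathcal I}\omega_k'(p)\,\Pi_k(p)f(p),\qquad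 p\in[0,2\pi),$$ and let $X_n=\frac1n W^{-n}XW^n$ for $n\ge1$. Then for every density matrix $\rho$ on $\mathcal H$ with $\operatorname{tr}(|X|\rho)<\infty$ there exists a constant $C>0$ such that for all integers $n\ge1$ $$L\big(F_{X_n}^\rho,F_V^\rho\big)\le C\,n^{-1/3}.$$ -/

import Mathlib

open MeasureTheory

noncomputable section

/-! ## Spectral projections, density matrices and distribution functions on a Hilbert space -/

section Hilbert

variable {E : Type*} [NormedAddCommGroup E] [InnerProductSpace ℂ E] [CompleteSpace E]

/-- `P` is the projection-valued spectral measure of the (possibly unbounded) operator `A`: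
the `P M` are orthogonal projections with `P ℝ = 1` and `P (M ∩ N) = P M P N`, countably additive
in the sense that `M ↦ ‖P M ψ‖² = ⟪ψ, P M ψ⟫` is a measure `μ_ψ` for every `ψ`, and `A = ∫ t dP(t)`,
that is, `D(A) = {ψ | ∫ t² dμ_ψ(t) < ∞}` and `⟪ψ, A ψ⟫ = ∫ t dμ_ψ(t)` for `ψ ∈ D(A)`. -/
structure IsSpectralMeasure (A : E →ₗ.[ℂ] E) (P : Set ℝ → E →L[ℂ] E) : Prop where
  isStarProjection : ∀ M, MeasurableSet M → IsStarProjection (P M)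
  univ : P Set.univ = 1
  inter : ∀ M N, MeasurableSet M → MeasurableSet N → P (M ∩ N) = P M * P N
  integral : ∀ ψ : E, ∃ μ : Measure ℝ,
    (∀ M, MeasurableSet M → μ M = ENNReal.ofReal (‖P M ψ‖ ^ 2)) ∧
    (ψ ∈ A.domain ↔ ∫⁻ t, ENNReal.ofReal (t ^ 2) ∂μ < ⊤) ∧
    ∀ h : ψ ∈ A.domain, inner ℂ ψ (A ⟨ψ, h⟩) = ((∫ t, t ∂μ : ℝ) : ℂ)

open Classical in
/-- The spectral projection `1_M(A)` of a selfadjoint operator `A` onto a Borel set `M ⊆ ℝ`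
(with the junk value `0` when `A` has no spectral measure, i.e. is not selfadjoint). -/
def spectralProjection (A : E →ₗ.[ℂ] E) (M : Set ℝ) : E →L[ℂ] E :=
  if h : ∃ P, IsSpectralMeasure A P then h.choose M else 0

variable (E) in
/-- The index set of a chosen orthonormal (Hilbert) basis of `E`. -/
def onbIndex : Set E := (exists_hilbertBasis ℂ E).choose

variable (E) in
/-- A chosen orthonormal (Hilbert) basis of `E`; traces are computed in this basis
(they do not depend on it). -/
def onb : HilbertBasis (onbIndex E) ℂ E := (exists_hilbertBasis ℂ E).choose_spec.choose

/-- The trace of a trace-class operator. -/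
def opTrace (T : E →L[ℂ] E) : ℂ := ∑' i, inner ℂ (onb E i) (T (onb E i))

/-- The trace of a positive bounded operator, with values in `[0, ∞]`. -/
def positiveTrace (T : E →L[ℂ] E) : ENNReal :=
  ∑' i, ENNReal.ofReal (inner ℂ (onb E i) (T (onb E i))).re

/-- Density matrices: positive (trace-class) operators of trace one. -/
structure IsDensityMatrix (ρ : E →L[ℂ] E) : Prop where
  isPositive : ρ.IsPositive
  trace_eq_one : positiveTrace ρ = 1

/-- The cumulative distribution function `F_A^ρ(x) = tr(ρ 1_{(-∞,x]}(A))`. -/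
def opCDF (ρ : E →L[ℂ] E) (A : E →ₗ.[ℂ] E) (x : ℝ) : ℝ :=
  (opTrace (ρ * spectralProjection A (Set.Iic x))).re

end Hilbert

/-- The Lévy distance
`L(F,G) = sup_x inf {ε > 0 | F (x - ε) - ε ≤ G x ≤ F (x + ε) + ε}`. -/
def levyDist (F G : ℝ → ℝ) : ℝ :=
  ⨆ x : ℝ, sInf {ε : ℝ | 0 < ε ∧ F (x - ε) - ε ≤ G x ∧ G x ≤ F (x + ε) + ε}

/-! ## The lattice Hilbert space and its Fourier transform -/

instance twoPiPos : Fact (0 < 2 * Real.pi) := ⟨Real.two_pi_pos⟩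

/-- The Hilbert space `ℓ²(ℤ; K)`. -/
abbrev LatticeSpace (K : Type*) [NormedAddCommGroup K] : Type _ := lp (fun _ : ℤ => K) 2

/-- The circle `𝕋 = ℝ / 2πℤ`. -/
abbrev Torus : Type := AddCircle (2 * Real.pi)

/-- `L²(𝕋; K)` for the normalised measure `dp / 2π`; the normalisation of the measure replaces
the prefactor `1 / √(2π)` of the Fourier transform. -/
abbrev MomentumSpace (K : Type*) [NormedAddCommGroup K] : Type _ :=
  Lp K 2 (AddCircle.haarAddCircle : Measure Torus)

section Lattice

variable {K : Type*} [NormedAddCommGroup K]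

/-- The right shift `(T ψ)_k = ψ_{k-1}`. -/
def rightShift (ψ : LatticeSpace K) : LatticeSpace K :=
  ⟨fun k => ψ (k - 1), (memℓp_gen_iff (by norm_num)).2
    (((memℓp_gen_iff (by norm_num)).1 (lp.memℓp ψ)).comp_injective
      (sub_left_injective (b := (1 : ℤ))))⟩

variable [InnerProductSpace ℂ K]

theorem memLp_planeWave (k : ℤ) (v : K) :
    MemLp (fun p : Torus => fourier k p • v) 2 AddCircle.haarAddCircle :=
  ((fourier k).continuous.smul continuous_const).memLp_of_hasCompactSupport
    (HasCompactSupport.of_compactSpace _)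

/-- The isometric embedding `v ↦ e^{ikp} v` of `K` into `L²(𝕋; K)`. -/
def planeWave (k : ℤ) : K →ₗᵢ[ℂ] MomentumSpace K where
  toFun v := (memLp_planeWave k v).toLp _
  map_add' v w := by
    rw [← MemLp.toLp_add]
    congr 1
    funext p
    simp
  map_smul' c v := by
    rw [RingHom.id_apply, ← MemLp.toLp_const_smul]
    congr 1
    funext p
    simp [smul_comm c]
  norm_map' v := by
    simp only [LinearMap.coe_mk, AddHom.coe_mk]
    rw [Lp.norm_toLp, eLpNorm_congr_norm_ae (g := fun _ => v)
      (Filter.Eventually.of_forall fun p => by rw [norm_smul, fourier_apply, Circle.norm_coe, one_mul])]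
    rw [eLpNorm_const v (by norm_num) (NeZero.ne _)]
    simp

theorem orthogonalFamily_planeWave [CompleteSpace K] :
    OrthogonalFamily ℂ (fun _ : ℤ => K) (planeWave (K := K)) := by
  intro j k hjk v w
  have h : inner ℂ (fourierLp (T := 2 * Real.pi) 2 j) (fourierLp (T := 2 * Real.pi) 2 k) = 0 :=
    (orthonormal_fourier (T := 2 * Real.pi)).2 hjk
  rw [L2.inner_def] at h ⊢
  have e : (fun p : Torus => inner ℂ ((planeWave j v : MomentumSpace K) p)
      ((planeWave k w : MomentumSpace K) p)) =ᵐ[AddCircle.haarAddCircle]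
      fun p => inner ℂ (fourierLp 2 j p) (fourierLp (T := 2 * Real.pi) 2 k p) * inner ℂ v w := by
    filter_upwards [(memLp_planeWave j v).coeFn_toLp, (memLp_planeWave k w).coeFn_toLp,
      coeFn_fourierLp (T := 2 * Real.pi) 2 j, coeFn_fourierLp (T := 2 * Real.pi) 2 k]
      with p h1 h2 h3 h4
    have h1' : (planeWave j v : MomentumSpace K) p = fourier j p • v := h1
    have h2' : (planeWave k w : MomentumSpace K) p = fourier k p • w := h2
    rw [h1', h2', h3, h4, inner_smul_left, inner_smul_right, RCLike.inner_apply]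
    ring
  rw [integral_congr_ae e, integral_mul_const, h, zero_mul]

/-- The Fourier transform `ℓ²(ℤ; K) → L²(𝕋; K)`, `(ℱ ψ)(p) = ∑ₖ ψₖ e^{ikp}`
(the series converging in `L²(𝕋; K)`). -/
def latticeFourier [CompleteSpace K] : LatticeSpace K →ₗᵢ[ℂ] MomentumSpace K :=
  (orthogonalFamily_planeWave (K := K)).linearIsometry

/-! ## Position and velocity operators -/

/-- The position operator `(X ψ)_k = k ψ_k` on its maximal domain. -/
def positionOp : LatticeSpace K →ₗ.[ℂ] LatticeSpace K where
  domain :=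
    { carrier := {ψ | Memℓp (fun k : ℤ => (k : ℂ) • ψ k) 2}
      add_mem' := fun {ψ φ} hψ hφ => by
        have h := Memℓp.add hψ hφ
        have e : (fun k : ℤ => (k : ℂ) • (ψ + φ) k) =
            (fun k : ℤ => (k : ℂ) • ψ k) + fun k : ℤ => (k : ℂ) • φ k := by
          funext k; simp
        simpa only [Set.mem_ofPred_eq, e] using h
      zero_mem' := by
        have e : (fun k : ℤ => (k : ℂ) • (0 : LatticeSpace K) k) = 0 := by
          funext k; simp
        simpa only [Set.mem_ofPred_eq, e] using zero_memℓp
      smul_mem' := fun c ψ hψ => by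
        have h := Memℓp.const_smul hψ c
        have e : (fun k : ℤ => (k : ℂ) • (c • ψ) k) = c • fun k : ℤ => (k : ℂ) • ψ k := by
          funext k; simp [smul_comm c]
        simpa only [Set.mem_ofPred_eq, e] using h }
  toFun :=
    { toFun := fun ψ => ⟨fun k : ℤ => (k : ℂ) • (ψ : LatticeSpace K) k, ψ.2⟩
      map_add' := fun ψ φ => by
        ext k
        exact smul_add (k : ℂ) ((ψ : LatticeSpace K) k) ((φ : LatticeSpace K) k)
      map_smul' := fun c ψ => by
        ext k
        exact smul_comm (k : ℂ) c ((ψ : LatticeSpace K) k) }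

/-- The rescaled Heisenberg position operator `Xₙ = W^{-n} X W^n / n`, with domain
`{ψ | W^n ψ ∈ D(X)}`. -/
def rescaledPositionOp (W : LatticeSpace K ≃ₗᵢ[ℂ] LatticeSpace K) (n : ℕ) :
    LatticeSpace K →ₗ.[ℂ] LatticeSpace K where
  domain := positionOp.domain.comap (W ^ n).toLinearEquiv.toLinearMap
  toFun := (n : ℂ)⁻¹ • ((W ^ n)⁻¹.toLinearEquiv.toLinearMap ∘ₗ positionOp.toFun ∘ₗ
    (W ^ n).toLinearEquiv.toLinearMap.restrict fun _ h => h)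

/-- `tr(|X| ρ) ∈ [0, ∞]` for a positive operator `ρ`, computed in the orthonormal basis
`δₓ ⊗ eᵢ` of eigenvectors of `|X|`, with `(eᵢ)` an orthonormal basis of `K`. -/
def traceAbsPosition [CompleteSpace K] (ρ : LatticeSpace K →L[ℂ] LatticeSpace K) : ENNReal :=
  ∑' (x : ℤ) (i : onbIndex K), ENNReal.ofReal (|(x : ℝ)| *
    (inner ℂ (lp.single 2 x (onb K i) : LatticeSpace K)
      (ρ (lp.single 2 x (onb K i)))).re)

/-- The representative in `[0, 2π)` of a point of the circle. -/
def torusRep (p : Torus) : ℝ := (AddCircle.equivIco (2 * Real.pi) 0 p : ℝ)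

variable {I : Type*}

/-- The graph of the velocity operator: the pairs `(ψ, φ)` such that, for almost every `p ∈ 𝕋`,
`(ℱ φ)(p) = ∑ₖ ωₖ'(p) Πₖ(p) (ℱ ψ)(p)`. -/
def velocityGraph [CompleteSpace K] (ω : I → ℝ → ℝ) (Pr : I → ℝ → K →L[ℂ] K) :
    Submodule ℂ (LatticeSpace K × LatticeSpace K) where
  carrier := {x | ∀ᵐ p ∂(AddCircle.haarAddCircle : Measure Torus),
    HasSum (fun k => ((deriv (ω k) (torusRep p) : ℝ) : ℂ) •
      Pr k (torusRep p) (latticeFourier x.1 p)) (latticeFourier x.2 p)}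
  add_mem' := fun {x y} hx hy => by
    simp only [Set.mem_ofPred_eq, Prod.fst_add, Prod.snd_add, map_add]
    filter_upwards [hx, hy, Lp.coeFn_add (latticeFourier x.1) (latticeFourier y.1),
      Lp.coeFn_add (latticeFourier x.2) (latticeFourier y.2)] with p h1 h2 h3 h4
    rw [h3, h4]
    simpa using h1.add h2
  zero_mem' := by
    simp only [Set.mem_ofPred_eq, Prod.fst_zero, Prod.snd_zero, map_zero]
    filter_upwards [Lp.coeFn_zero K 2 (AddCircle.haarAddCircle : Measure Torus)] with p h
    rw [h]
    simp
  smul_mem' := fun c x hx => by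
    simp only [Set.mem_ofPred_eq, Prod.smul_fst, Prod.smul_snd, map_smul]
    filter_upwards [hx, Lp.coeFn_smul c (latticeFourier x.1),
      Lp.coeFn_smul c (latticeFourier x.2)] with p h1 h2 h3
    rw [h2, h3]
    simpa [smul_comm c] using h1.const_smul c

/-- The velocity operator `V`, on its maximal domain:
`(ℱ V ℱ* f)(p) = ∑ₖ ωₖ'(p) Πₖ(p) f(p)`. -/
def velocityOp [CompleteSpace K] (ω : I → ℝ → ℝ) (Pr : I → ℝ → K →L[ℂ] K) :
    LatticeSpace K →ₗ.[ℂ] LatticeSpace K :=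
  (velocityGraph ω Pr).toLinearPMap

end Lattice

end

/-! The proof compares characteristic functions and then passes to distribution functions by a
smoothing inequality.

Put s = u/n. At u, the characteristic functions of Xₙ and V come from W^{-n} e^{isX} W^n and
e^{insV}. In momentum space e^{isX} is translation by s (`latticeFourier_phaseOp`). Hence, for a
vector ψ with Fourier transform f, applying W^n reduces the comparison to Ŵ(p+s)^n f(p+s) against
Ŵ(p)^n ∑ₖ e^{insωₖ'(p)} Πₖ(p) f(p). Three errors arise. Replacing f(p+s) by f(p) costs ‖e^{isX}ψ -
ψ‖, which is of order √|s| because only a first absolute moment is available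
(`norm_phaseOp_sub_sq_le`). Replacing Πₖ(p+s) by Πₖ(p) costs |s| ∑ₖ sup‖Πₖ'‖. Linearising n ωₖ(p+s)
costs n s² sup|ωₖ''| (`norm_fibre_sub_le`). A density matrix is reduced to the vectors ψᵢ = √ρ eᵢ,
whose squared norms sum to 1 and whose first absolute moments sum to tr(|X|ρ).

With ε = n^{-1/3} the three errors are at most a constant times ε (|εu| + (εu)² + √|εu|). Smoothing
at scale ε probes frequencies u ~ 1/ε, where both u²/n and √(u/n) are of order ε; this balance fixes
the exponent 1/3. The smoothing inequality (`levyDist_le_of_charFun`) then gives a Lévy distance of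
order ε.

Since `spectralProjection` is an arbitrary choice among spectral measures, its value on half-lines
must also be shown to be unique (`Iic_eq_of_isSpectralMeasure`). This is done by comparison with
explicit Borel functional calculi for Xₙ and V. -/

noncomputable section

set_option linter.unusedSectionVars false

/-! ### Smoothing inequality: from characteristic functions to the Lévy distance. -/

section Smoothing

open FourierTransform Filter Topology

/-- A smooth probability density supported in `[-1, 1]`. -/
def smoothKernel : ℝ → ℝ :=
  (⟨1 / 2, 1, by norm_num, by norm_num⟩ : ContDiffBump (0 : ℝ)).normed volume

theorem contDiff_smoothKernel : ContDiff ℝ ((⊤ : ℕ∞) : WithTop ℕ∞) smoothKernel :=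
  ContDiffBump.contDiff_normed _

theorem smoothKernel_nonneg (t : ℝ) : 0 ≤ smoothKernel t := ContDiffBump.nonneg_normed _ t

theorem support_smoothKernel : Function.support smoothKernel = Set.Ioo (-1) 1 := by
  rw [smoothKernel, ContDiffBump.support_normed_eq, Real.ball_eq_Ioo]
  norm_num

theorem integral_smoothKernel : ∫ t, smoothKernel t = 1 := ContDiffBump.integral_normed _

theorem continuous_smoothKernel : Continuous smoothKernel := contDiff_smoothKernel.continuous

theorem hasCompactSupport_smoothKernel : HasCompactSupport smoothKernel :=
  ContDiffBump.hasCompactSupport_normed _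

theorem integrable_smoothKernel : Integrable smoothKernel :=
  continuous_smoothKernel.integrable_of_hasCompactSupport hasCompactSupport_smoothKernel

/-- `smoothKernel` as a complex-valued Schwartz function. -/
def schwartzKernel : SchwartzMap ℝ ℂ :=
  (hasCompactSupport_smoothKernel.comp_left (g := ((↑) : ℝ → ℂ)) rfl).toSchwartzMap
    (Complex.ofRealCLM.contDiff.comp contDiff_smoothKernel)

theorem schwartzKernel_apply (t : ℝ) : schwartzKernel t = smoothKernel t := rfl

theorem smoothKernel_eq_integral (t : ℝ) :
    (smoothKernel t : ℂ) =
      ∫ w : ℝ, Complex.exp (((2 * Real.pi * w * t : ℝ) : ℂ) * Complex.I) * 𝓕 schwartzKernel w := by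
  have h : 𝓕⁻ (𝓕 schwartzKernel) = schwartzKernel := fourierInv_fourier_eq _
  have h2 := congrArg (fun f : SchwartzMap ℝ ℂ => f t) h
  simp only [SchwartzMap.fourierInv_coe] at h2
  rw [Real.fourierInv_eq'] at h2
  rw [← schwartzKernel_apply, ← h2]
  congr 1; funext w
  simp [smul_eq_mul]
  left
  congr 1
  ring

/-- The smoothed indicator function of the interval `[α, β]`. -/
def smoothIndicator (α β τ : ℝ) : ℝ := ∫ y in α..β, smoothKernel (τ - y)

theorem smoothIndicator_eq (α β τ : ℝ) :
    smoothIndicator α β τ = ∫ s in (τ - β)..(τ - α), smoothKernel s := by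
  rw [smoothIndicator, intervalIntegral.integral_comp_sub_left (fun s => smoothKernel s)]

theorem smoothIndicator_nonneg {α β : ℝ} (h : α ≤ β) (τ : ℝ) : 0 ≤ smoothIndicator α β τ :=
  intervalIntegral.integral_nonneg h fun _ _ => smoothKernel_nonneg _

theorem smoothIndicator_le_one {α β : ℝ} (h : α ≤ β) (τ : ℝ) : smoothIndicator α β τ ≤ 1 := by
  rw [smoothIndicator_eq, intervalIntegral.integral_of_le (by linarith), ← integral_smoothKernel]
  exact setIntegral_le_integral integrable_smoothKernel (Eventually.of_forall smoothKernel_nonneg)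

theorem smoothIndicator_eq_one {α β τ : ℝ} (h1 : α + 1 ≤ τ) (h2 : τ ≤ β - 1) :
    smoothIndicator α β τ = 1 := by
  rw [smoothIndicator_eq, intervalIntegral.integral_eq_integral_of_support_subset,
    integral_smoothKernel]
  rw [support_smoothKernel]
  intro s hs
  exact ⟨by linarith [hs.1], by linarith [hs.2]⟩

theorem smoothIndicator_eq_zero {α β τ : ℝ} (h : α ≤ β) (h2 : β + 1 ≤ τ) :
    smoothIndicator α β τ = 0 := by
  rw [smoothIndicator_eq]
  rw [intervalIntegral.integral_congr (g := fun _ => 0)]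
  · simp
  · intro s hs
    rw [Set.uIcc_of_le (by linarith)] at hs
    have : s ∉ Function.support smoothKernel := by
      rw [support_smoothKernel]
      intro hs'
      linarith [hs.1, hs'.2]
    simpa using this

/-- The Fourier transform of the indicator function of `[α, β]`. -/
def fourierIndicator (α β w : ℝ) : ℂ :=
  ∫ y in α..β, Complex.exp (((-(2 * Real.pi * w) : ℝ) : ℂ) * Complex.I * y)

/-- The bound does not depend on the endpoints, which later allows α → -∞ and so reaches half-lines.
-/
theorem norm_fourierIndicator_le (α β : ℝ) {w : ℝ} (hw : w ≠ 0) :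
    ‖fourierIndicator α β w‖ ≤ 1 / (Real.pi * |w|) := by
  have hc : (((-(2 * Real.pi * w) : ℝ) : ℂ) * Complex.I) ≠ 0 := by
    simp [hw, Real.pi_ne_zero]
  have e (y : ℝ) : ‖Complex.exp (((-(2 * Real.pi * w) : ℝ) : ℂ) * Complex.I * y)‖ = 1 := by
    rw [show ((-(2 * Real.pi * w) : ℝ) : ℂ) * Complex.I * y =
      ((-(2 * Real.pi * w) * y : ℝ) : ℂ) * Complex.I by push_cast; ring,
      Complex.norm_exp_ofReal_mul_I]
  rw [fourierIndicator, integral_exp_mul_complex hc, norm_div]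
  have h1 : ‖(((-(2 * Real.pi * w) : ℝ) : ℂ) * Complex.I)‖ = 2 * (Real.pi * |w|) := by
    rw [norm_mul, Complex.norm_I, mul_one, Complex.norm_real, norm_neg, Real.norm_eq_abs, abs_mul,
      abs_of_pos Real.two_pi_pos]
    ring
  have hp : 0 < Real.pi * |w| := mul_pos Real.pi_pos (abs_pos.2 hw)
  rw [h1, div_le_div_iff₀ (by linarith) hp]
  have := norm_sub_le (Complex.exp (((-(2 * Real.pi * w) : ℝ) : ℂ) * Complex.I * β))
    (Complex.exp (((-(2 * Real.pi * w) : ℝ) : ℂ) * Complex.I * α))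
  rw [e, e] at this
  nlinarith

/-- Bounded also near w = 0, where 1/(π|w|) is not integrable; it serves only to justify Fubini and
integrability. -/
theorem norm_fourierIndicator_le_length {α β : ℝ} (h : α ≤ β) (w : ℝ) :
    ‖fourierIndicator α β w‖ ≤ β - α := by
  have := intervalIntegral.norm_integral_le_of_norm_le_const (a := α) (b := β) (C := 1)
    (f := fun y : ℝ => Complex.exp (((-(2 * Real.pi * w) : ℝ) : ℂ) * Complex.I * y)) (by
      intro y _
      rw [show ((-(2 * Real.pi * w) : ℝ) : ℂ) * Complex.I * y =
        ((-(2 * Real.pi * w) * y : ℝ) : ℂ) * Complex.I by push_cast; ring,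
        Complex.norm_exp_ofReal_mul_I])
  rwa [one_mul, abs_of_nonneg (by linarith)] at this

theorem continuous_fourierIndicator (α β : ℝ) : Continuous (fourierIndicator α β) := by
  unfold fourierIndicator
  apply intervalIntegral.continuous_parametric_intervalIntegral_of_continuous'
  simp only [Function.uncurry_def]
  fun_prop

theorem smoothIndicator_eq_integral {α β : ℝ} (h : α ≤ β) (τ : ℝ) :
    (smoothIndicator α β τ : ℂ) = ∫ w : ℝ,
      Complex.exp (((2 * Real.pi * w * τ : ℝ) : ℂ) * Complex.I) * fourierIndicator α β w *
        𝓕 schwartzKernel w := by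
  rw [smoothIndicator, ← intervalIntegral.integral_ofReal]
  simp_rw [smoothKernel_eq_integral]
  rw [intervalIntegral.integral_of_le h, integral_integral_swap]
  · congr 1; funext w
    rw [fourierIndicator, ← intervalIntegral.integral_of_le h,
      ← intervalIntegral.integral_const_mul, ← intervalIntegral.integral_mul_const]
    congr 1; funext y
    rw [← Complex.exp_add]
    congr 2
    push_cast
    ring
  · have h1 : Integrable (fun z : ℝ × ℝ => (1 : ℂ) * 𝓕 schwartzKernel z.2)
        ((volume.restrict (Set.Ioc α β)).prod volume) :=
      (integrable_const (1 : ℂ)).mul_prod (𝓕 schwartzKernel).integrable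
    refine h1.mono ?_ (Eventually.of_forall fun z => ?_)
    · apply Continuous.aestronglyMeasurable
      have := (𝓕 schwartzKernel).continuous
      simp only [Function.uncurry_def]
      fun_prop
    · simp only [Function.uncurry_def, norm_mul, Complex.norm_exp_ofReal_mul_I, norm_one, le_refl]

theorem continuous_smoothIndicator (α β : ℝ) : Continuous (smoothIndicator α β) := by
  unfold smoothIndicator
  apply intervalIntegral.continuous_parametric_intervalIntegral_of_continuous'
  have := continuous_smoothKernel
  simp only [Function.uncurry_def]
  fun_prop

theorem integrable_smoothIndicator {α β : ℝ} (h : α ≤ β) (μ : Measure ℝ) [IsFiniteMeasure μ] :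
    Integrable (smoothIndicator α β) μ :=
  Integrable.of_bound (continuous_smoothIndicator α β).aestronglyMeasurable 1
    (Eventually.of_forall fun τ => by
      rw [Real.norm_eq_abs, abs_of_nonneg (smoothIndicator_nonneg h τ)]
      exact smoothIndicator_le_one h τ)

theorem integral_smoothIndicator {α β : ℝ} (h : α ≤ β) (μ : Measure ℝ) [IsFiniteMeasure μ] :
    ((∫ τ, smoothIndicator α β τ ∂μ : ℝ) : ℂ) = ∫ w : ℝ,
      charFun μ (2 * Real.pi * w) * (fourierIndicator α β w * 𝓕 schwartzKernel w) := by
  rw [← integral_complex_ofReal]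
  simp_rw [smoothIndicator_eq_integral h]
  rw [integral_integral_swap]
  · congr 1; funext w
    rw [charFun_apply_real, ← integral_mul_const]
    congr 1; funext τ
    rw [mul_assoc]
    congr 3
    push_cast
    ring
  · have h1 : Integrable (fun z : ℝ × ℝ => ((β - α : ℝ) : ℂ) * 𝓕 schwartzKernel z.2)
        (μ.prod volume) :=
      (integrable_const ((β - α : ℝ) : ℂ)).mul_prod (𝓕 schwartzKernel).integrable
    refine h1.mono ?_ (Eventually.of_forall fun z => ?_)
    · apply Continuous.aestronglyMeasurable
      have := (𝓕 schwartzKernel).continuous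
      have := continuous_fourierIndicator α β
      simp only [Function.uncurry_def]
      fun_prop
    · simp only [Function.uncurry_def, norm_mul, Complex.norm_exp_ofReal_mul_I, one_mul]
      gcongr
      refine (norm_fourierIndicator_le_length h _).trans ?_
      rw [Complex.norm_real]
      exact le_abs_self _

theorem integrable_charFun_mul (α β : ℝ) (h : α ≤ β) (μ : Measure ℝ) [IsFiniteMeasure μ] :
    Integrable fun w : ℝ =>
      charFun μ (2 * Real.pi * w) * (fourierIndicator α β w * 𝓕 schwartzKernel w) := by
  have h1 : Integrable (fun w : ℝ => ((μ.real Set.univ * (β - α) : ℝ) : ℂ) * 𝓕 schwartzKernel w) :=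
    (𝓕 schwartzKernel).integrable.const_mul _
  refine h1.mono ?_ (Eventually.of_forall fun w => ?_)
  · apply Measurable.aestronglyMeasurable
    have := (𝓕 schwartzKernel).continuous.measurable
    have := (continuous_fourierIndicator α β).measurable
    have := measurable_charFun (μ := μ)
    fun_prop
  · simp only [norm_mul, Complex.norm_real, ← mul_assoc]
    gcongr
    · exact (norm_charFun_le _).trans (le_abs_self _)
    · exact (norm_fourierIndicator_le_length h _).trans (le_abs_self _)

/-- The weight dominates (|u| + u² + √|u|) / (π|w|) at u = 2πw. Its singularity at 0 is only
|w|^{-1/2}, and the Schwartz decay handles infinity. -/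
theorem integrable_sqrt_weight :
    Integrable fun w : ℝ => (2 + 4 * Real.pi * |w| + 1 / √|w|) * ‖𝓕 schwartzKernel w‖ := by
  have h0 : Integrable fun w : ℝ => ‖𝓕 schwartzKernel w‖ := (𝓕 schwartzKernel).integrable.norm
  have h1 : Integrable fun w : ℝ => |w| * ‖𝓕 schwartzKernel w‖ := by
    simpa using SchwartzMap.integrable_pow_mul volume (𝓕 schwartzKernel) 1
  have h2 : Integrable fun w : ℝ => 1 / √|w| * ‖𝓕 schwartzKernel w‖ := by
    obtain ⟨C, hC⟩ : ∃ C, ∀ w, ‖𝓕 schwartzKernel w‖ ≤ C :=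
      ⟨_, fun w => SchwartzMap.norm_le_seminorm ℝ (𝓕 schwartzKernel) w⟩
    have hI : IntegrableOn (fun w : ℝ => 1 / √|w|) (Set.Icc (-1) 1) := by
      have h3 : IntegrableOn (fun w : ℝ => 1 / √|w|) (Set.Ioc 0 1) := by
        have := (intervalIntegral.intervalIntegrable_rpow' (a := 0) (b := 1)
          (r := -(1 / 2)) (by norm_num)).1
        refine this.congr_fun (fun w hw => ?_) measurableSet_Ioc
        simp only
        rw [abs_of_pos hw.1, Real.sqrt_eq_rpow, Real.rpow_neg hw.1.le]
        simp only [one_div]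
      have h4 : IntegrableOn (fun w : ℝ => 1 / √|w|) (Set.Ico (-1) 0) := by
        have := h3.comp_neg
        simpa using this
      have h5 : IntegrableOn (fun w : ℝ => 1 / √|w|) {0} := by simp
      refine ((h4.union h5).union h3).mono_set fun w hw => ?_
      rcases lt_trichotomy w 0 with h | h | h
      · exact Or.inl (Or.inl ⟨hw.1, h⟩)
      · exact Or.inl (Or.inr h)
      · exact Or.inr ⟨h, hw.2⟩
    have h3 : Integrable ((Set.Icc (-1) 1).indicator (fun w : ℝ => 1 / √|w|)) :=
      hI.integrable_indicator measurableSet_Icc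
    refine ((h3.mul_const C).add h0).mono' ?_ (Eventually.of_forall fun w => ?_)
    · apply Measurable.aestronglyMeasurable
      have := (𝓕 schwartzKernel).continuous.measurable
      fun_prop
    · rw [Real.norm_eq_abs, abs_of_nonneg (by positivity), Pi.add_apply]
      by_cases hw : w ∈ Set.Icc (-1 : ℝ) 1
      · rw [Set.indicator_of_mem hw]
        have : 1 / √|w| * ‖𝓕 schwartzKernel w‖ ≤ 1 / √|w| * C :=
          mul_le_mul_of_nonneg_left (hC w) (by positivity)
        linarith [norm_nonneg (𝓕 schwartzKernel w)]
      · rw [Set.indicator_of_notMem hw, zero_mul, zero_add]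
        have h1 : 1 ≤ |w| := by
          by_contra! h
          exact hw ⟨by linarith [(abs_lt.1 h).1], (abs_lt.1 h).2.le⟩
        have h2 : 1 / √|w| ≤ 1 := by
          rw [div_le_one (by positivity)]
          exact Real.one_le_sqrt.2 h1
        exact mul_le_of_le_one_left (norm_nonneg _) h2
  have := ((h0.const_mul 2).add (h1.const_mul (4 * Real.pi))).add h2
  refine this.congr (Eventually.of_forall fun w => ?_)
  simp only [Pi.add_apply]
  ring

/-- The constant of the smoothing inequality. -/
def smoothingConst : ℝ :=
  ∫ w : ℝ, (2 + 4 * Real.pi * |w| + 1 / √|w|) * ‖𝓕 schwartzKernel w‖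

theorem smoothingConst_nonneg : 0 ≤ smoothingConst :=
  integral_nonneg fun w => by positivity

/-- By Fourier inversion the difference is an integral of the difference of characteristic functions
against the transform of the smoothed indicator. The factor 1/(π|w|) of that transform is absorbed
by the vanishing of the hypothesis at u = 0, so the bound is uniform in α and β. -/
theorem integral_smoothIndicator_sub_le {μ ν : Measure ℝ} [IsFiniteMeasure μ] [IsFiniteMeasure ν]
    {D : ℝ} (hD : ∀ u : ℝ, ‖charFun μ u - charFun ν u‖ ≤ D * (|u| + u ^ 2 + √|u|))
    {α β : ℝ} (h : α ≤ β) :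
    ∫ τ, smoothIndicator α β τ ∂μ - ∫ τ, smoothIndicator α β τ ∂ν ≤ D * smoothingConst := by
  have e : ((∫ τ, smoothIndicator α β τ ∂μ - ∫ τ, smoothIndicator α β τ ∂ν : ℝ) : ℂ) =
      ∫ w : ℝ, (charFun μ (2 * Real.pi * w) - charFun ν (2 * Real.pi * w)) *
        (fourierIndicator α β w * 𝓕 schwartzKernel w) := by
    rw [Complex.ofReal_sub, integral_smoothIndicator h, integral_smoothIndicator h,
      ← integral_sub (integrable_charFun_mul α β h μ) (integrable_charFun_mul α β h ν)]
    simp_rw [sub_mul]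
  have hD0 : 0 ≤ D := by
    have := (norm_nonneg _).trans (hD 1)
    norm_num at this
    linarith
  calc _ ≤ ‖((∫ τ, smoothIndicator α β τ ∂μ - ∫ τ, smoothIndicator α β τ ∂ν : ℝ) : ℂ)‖ := by
        rw [Complex.norm_real]; exact le_abs_self _
    _ ≤ ∫ w : ℝ, D * ((2 + 4 * Real.pi * |w| + 1 / √|w|) * ‖𝓕 schwartzKernel w‖) := by
        rw [e]
        refine norm_integral_le_of_norm_le (integrable_sqrt_weight.const_mul D) ?_
        have h0 : ∀ᵐ w : ℝ, w ≠ 0 := by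
          simp [ae_iff, measure_singleton]
        filter_upwards [h0] with w hw
        rw [norm_mul, norm_mul]
        have hw' : 0 < |w| := abs_pos.2 hw
        have hs : √|w| * √|w| = |w| := Real.mul_self_sqrt hw'.le
        have hs0 : 0 < √|w| := Real.sqrt_pos.2 hw'
        have hu : |2 * Real.pi * w| = 2 * Real.pi * |w| := by
          rw [abs_mul, abs_of_pos Real.two_pi_pos]
        -- Uses 2π ≤ π²; it turns √|u| / (π|w|) into at most 1/√|w|.
        have hsq : √(2 * Real.pi * |w|) ≤ Real.pi * √|w| := by
          rw [Real.sqrt_mul Real.two_pi_pos.le]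
          gcongr
          rw [Real.sqrt_le_left Real.pi_pos.le]
          nlinarith [Real.pi_gt_three]
        have h1 : |2 * Real.pi * w| + (2 * Real.pi * w) ^ 2 + √|2 * Real.pi * w| ≤
            (2 + 4 * Real.pi * |w| + 1 / √|w|) * (Real.pi * |w|) := by
          have : 1 / √|w| * (Real.pi * |w|) = Real.pi * √|w| := by
            field_simp
            nlinarith
          have hsqr : (2 * Real.pi * w) ^ 2 = 4 * Real.pi * |w| * (Real.pi * |w|) := by
            rw [← sq_abs, hu]; ring
          rw [add_mul, this, hu, hsqr]
          linarith
        have h2 := norm_fourierIndicator_le α β hw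
        calc _ ≤ (D * ((2 + 4 * Real.pi * |w| + 1 / √|w|) * (Real.pi * |w|))) *
              (1 / (Real.pi * |w|) * ‖𝓕 schwartzKernel w‖) := by
              have := hD (2 * Real.pi * w)
              gcongr
              exact this.trans (by gcongr)
          _ = _ := by
              have := Real.pi_pos
              field_simp
    _ = D * smoothingConst := by rw [integral_const_mul, smoothingConst]

/-- Smoothing inequality, at unit scale. -/
theorem real_Iic_le_of_charFun {μ ν : Measure ℝ} [IsFiniteMeasure μ] [IsFiniteMeasure ν]
    {D : ℝ} (hD : ∀ u : ℝ, ‖charFun μ u - charFun ν u‖ ≤ D * (|u| + u ^ 2 + √|u|)) (x : ℝ) :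
    μ.real (Set.Iic x) ≤ ν.real (Set.Iic (x + 2)) + D * smoothingConst := by
  -- The smoothed indicator of [a - 1, x + 1] equals 1 on (a, x] and vanishes beyond x + 2, as the
  -- kernel has support in [-1, 1]. The error is independent of a, so a → -∞ is harmless.
  have key : ∀ a, a ≤ x → μ.real (Set.Ioc a x) ≤ ν.real (Set.Iic (x + 2)) + D * smoothingConst := by
    intro a ha
    have hab : a - 1 ≤ x + 1 := by linarith
    have h1 : μ.real (Set.Ioc a x) ≤ ∫ τ, smoothIndicator (a - 1) (x + 1) τ ∂μ := by
      rw [← integral_indicator_one measurableSet_Ioc]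
      refine integral_mono ((integrable_const 1).indicator measurableSet_Ioc)
        (integrable_smoothIndicator hab μ) fun τ => ?_
      by_cases hτ : τ ∈ Set.Ioc a x
      · rw [Set.indicator_of_mem hτ, smoothIndicator_eq_one (by linarith [hτ.1]) (by linarith [hτ.2])]
        rfl
      · rw [Set.indicator_of_notMem hτ]
        exact smoothIndicator_nonneg hab τ
    have h2 : ∫ τ, smoothIndicator (a - 1) (x + 1) τ ∂ν ≤ ν.real (Set.Iic (x + 2)) := by
      rw [← integral_indicator_one measurableSet_Iic]
      refine integral_mono (integrable_smoothIndicator hab ν)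
        ((integrable_const 1).indicator measurableSet_Iic) fun τ => ?_
      by_cases hτ : τ ∈ Set.Iic (x + 2)
      · rw [Set.indicator_of_mem hτ]
        exact smoothIndicator_le_one hab τ
      · rw [Set.indicator_of_notMem hτ,
          smoothIndicator_eq_zero hab (by rw [Set.mem_Iic, not_le] at hτ; linarith)]
    linarith [integral_smoothIndicator_sub_le hD hab]
  have ht := (ENNReal.tendsto_toReal (measure_ne_top μ (Set.Iic x))).comp
    (tendsto_measure_Ioc_atBot μ x)
  refine le_of_tendsto ht ?_
  filter_upwards [eventually_le_atBot x] with a ha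
  exact key a ha

/-- Smoothing inequality, at scale `ε`. -/
theorem real_Iic_le_of_charFun_scaled {μ ν : Measure ℝ} [IsFiniteMeasure μ] [IsFiniteMeasure ν]
    {D ε : ℝ} (hε : 0 < ε) (hD : ∀ u : ℝ, ‖charFun μ u - charFun ν u‖ ≤
      D * (|ε * u| + (ε * u) ^ 2 + √|ε * u|)) (x : ℝ) :
    μ.real (Set.Iic x) ≤ ν.real (Set.Iic (x + 2 * ε)) + D * smoothingConst := by
  have hm : Measurable fun t : ℝ => ε⁻¹ * t := by fun_prop
  have e (μ : Measure ℝ) (y : ℝ) :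
      (μ.map fun t => ε⁻¹ * t).real (Set.Iic (ε⁻¹ * y)) = μ.real (Set.Iic y) := by
    rw [Measure.real, Measure.real, Measure.map_apply hm measurableSet_Iic]
    congr 2
    ext t
    rw [Set.mem_preimage, Set.mem_Iic, Set.mem_Iic, mul_le_mul_iff_right₀ (inv_pos.2 hε)]
  have := real_Iic_le_of_charFun (μ := μ.map fun t => ε⁻¹ * t) (ν := ν.map fun t => ε⁻¹ * t)
    (D := D) (fun u => by
      rw [charFun_map_mul, charFun_map_mul]
      refine (hD _).trans_eq ?_
      rw [mul_inv_cancel_left₀ hε.ne']) (ε⁻¹ * x)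
  rw [e, show ε⁻¹ * x + 2 = ε⁻¹ * (x + 2 * ε) by field_simp, e] at this
  exact this

theorem levyDist_le_of_forall {F G : ℝ → ℝ} {η : ℝ} (hη : 0 < η)
    (h : ∀ x, F (x - η) - η ≤ G x ∧ G x ≤ F (x + η) + η) : levyDist F G ≤ η :=
  ciSup_le fun x => csInf_le ⟨0, fun _ hε => hε.1.le⟩ ⟨hη, h x⟩

/-- Lévy distance from closeness of characteristic functions. -/
theorem levyDist_le_of_charFun {μ ν : Measure ℝ} [IsFiniteMeasure μ] [IsFiniteMeasure ν]
    {D ε : ℝ} (hε : 0 < ε) (hD : ∀ u : ℝ, ‖charFun μ u - charFun ν u‖ ≤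
      D * ε * (|ε * u| + (ε * u) ^ 2 + √|ε * u|)) :
    levyDist (fun x => μ.real (Set.Iic x)) (fun x => ν.real (Set.Iic x)) ≤
      (2 + D * smoothingConst) * ε := by
  have hD0 : 0 ≤ D := by
    have := (norm_nonneg _).trans (hD (ε⁻¹))
    rw [mul_inv_cancel₀ hε.ne'] at this
    norm_num at this
    nlinarith
  have hB := mul_nonneg hD0 smoothingConst_nonneg
  -- One number must serve as horizontal shift (at least 2ε) and as vertical error (at least D ε
  -- times the smoothing constant); the sum does both.
  have hη : 2 * ε ≤ (2 + D * smoothingConst) * ε := by nlinarith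
  have mono (μ : Measure ℝ) [IsFiniteMeasure μ] {x y : ℝ} (h : x ≤ y) :
      μ.real (Set.Iic x) ≤ μ.real (Set.Iic y) := measureReal_mono (Set.Iic_subset_Iic.2 h)
  refine levyDist_le_of_forall (by positivity) fun x => ⟨?_, ?_⟩
  · have h1 := real_Iic_le_of_charFun_scaled hε hD (x - (2 + D * smoothingConst) * ε)
    have h2 := mono ν (x := x - (2 + D * smoothingConst) * ε + 2 * ε) (y := x) (by linarith)
    nlinarith
  · have h1 := real_Iic_le_of_charFun_scaled hε (μ := ν) (ν := μ) (D := D * ε)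
      (fun u => by rw [norm_sub_rev]; exact hD u) x
    have h2 := mono μ (x := x + 2 * ε) (y := x + (2 + D * smoothingConst) * ε) (by linarith)
    nlinarith

end Smoothing

/-! ### Borel functional calculus and uniqueness of spectral projections onto half-lines. -/

/-- Bounded Borel functions on the line. -/
structure IsBoundedBorel (g : ℝ → ℂ) : Prop where
  measurable : Measurable g
  bounded : ∃ C, ∀ t, ‖g t‖ ≤ C

namespace IsBoundedBorel

theorem const (c : ℂ) : IsBoundedBorel fun _ => c := ⟨measurable_const, ‖c‖, fun _ => le_rfl⟩

theorem mul {g h : ℝ → ℂ} (hg : IsBoundedBorel g) (hh : IsBoundedBorel h) :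
    IsBoundedBorel fun t => g t * h t := by
  obtain ⟨C, hC⟩ := hg.bounded
  obtain ⟨D, hD⟩ := hh.bounded
  refine ⟨hg.measurable.mul hh.measurable, C * D, fun t => ?_⟩
  rw [norm_mul]
  exact mul_le_mul (hC t) (hD t) (norm_nonneg _) ((norm_nonneg _).trans (hC t))

theorem star {g : ℝ → ℂ} (hg : IsBoundedBorel g) : IsBoundedBorel fun t => star (g t) := by
  obtain ⟨C, hC⟩ := hg.bounded
  exact ⟨continuous_star.measurable.comp hg.measurable, C, fun t => by rw [norm_star]; exact hC t⟩

theorem indicator {M : Set ℝ} (hM : MeasurableSet M) :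
    IsBoundedBorel (M.indicator fun _ => 1) := by
  refine ⟨measurable_const.indicator hM, 1, fun t => ?_⟩
  exact (norm_indicator_le_norm_self (fun _ => (1 : ℂ)) t).trans (by simp)

theorem exp (u : ℝ) : IsBoundedBorel fun t => Complex.exp (u * t * Complex.I) := by
  refine ⟨by fun_prop, 1, fun t => ?_⟩
  rw [← Complex.ofReal_mul, Complex.norm_exp_ofReal_mul_I]

theorem integrable {g : ℝ → ℂ} (hg : IsBoundedBorel g) (μ : Measure ℝ) [IsFiniteMeasure μ] :
    Integrable g μ :=
  let ⟨C, hC⟩ := hg.bounded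
  Integrable.of_bound hg.measurable.aestronglyMeasurable C (Filter.Eventually.of_forall hC)

end IsBoundedBorel

section Hilbert

variable {E : Type*} [NormedAddCommGroup E] [InnerProductSpace ℂ E] [CompleteSpace E]

/-- `Φ` is a bounded Borel functional calculus of the operator `A`. -/
structure IsBorelCalculus (A : E →ₗ.[ℂ] E) (Φ : (ℝ → ℂ) → E →L[ℂ] E) : Prop where
  map_one : Φ (fun _ => 1) = 1
  map_mul : ∀ g h, IsBoundedBorel g → IsBoundedBorel h → Φ (fun t => g t * h t) = Φ g * Φ h
  map_star : ∀ g, IsBoundedBorel g → Φ (fun t => star (g t)) = star (Φ g)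
  measure : ∀ ψ : E, ∃ μ : Measure ℝ, IsFiniteMeasure μ ∧
    (∀ g, IsBoundedBorel g → inner ℂ ψ (Φ g ψ) = ∫ t, g t ∂μ) ∧
    (ψ ∈ A.domain ↔ ∫⁻ t, ENNReal.ofReal (t ^ 2) ∂μ < ⊤) ∧
    ∀ h : ψ ∈ A.domain, inner ℂ ψ (A ⟨ψ, h⟩) = ((∫ t, t ∂μ : ℝ) : ℂ)
  -- With g = 1_M(t)/(t - c) this inverts A - c on the spectral subspace of M, which drives the
  -- uniqueness argument.
  apply_sub : ∀ (c : ℝ) (g : ℝ → ℂ), IsBoundedBorel g →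
    IsBoundedBorel (fun t => ((t : ℂ) - c) * g t) → ∀ ψ, ∃ h : Φ g ψ ∈ A.domain,
      A ⟨Φ g ψ, h⟩ - (c : ℂ) • Φ g ψ = Φ (fun t => ((t : ℂ) - c) * g t) ψ

theorem norm_sq_starProjection {P : E →L[ℂ] E} (hP : IsStarProjection P) (ψ : E) :
    inner ℂ ψ (P ψ) = ((‖P ψ‖ ^ 2 : ℝ) : ℂ) := by
  have h1 : P ψ = P (P ψ) := by
    conv_lhs => rw [← hP.isIdempotentElem.eq]
    rfl
  rw [h1, ← ContinuousLinearMap.adjoint_inner_left, ← ContinuousLinearMap.star_eq_adjoint,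
    hP.isSelfAdjoint.star_eq, ← h1, inner_self_eq_norm_sq_to_K]
  norm_cast

theorem inner_starProjection_left {P : E →L[ℂ] E} (hP : IsStarProjection P) (φ ψ : E) :
    inner ℂ (P φ) ψ = inner ℂ φ (P ψ) := by
  rw [← ContinuousLinearMap.adjoint_inner_left, ← ContinuousLinearMap.star_eq_adjoint,
    hP.isSelfAdjoint.star_eq]

namespace IsSpectralMeasure

variable {A : E →ₗ.[ℂ] E} {P : Set ℝ → E →L[ℂ] E}

theorem inter_apply (hP : IsSpectralMeasure A P) {M N : Set ℝ} (hM : MeasurableSet M)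
    (hN : MeasurableSet N) (ψ : E) : P M (P N ψ) = P (M ∩ N) ψ := by
  rw [hP.inter M N hM hN]; rfl

theorem self_apply (hP : IsSpectralMeasure A P) {M : Set ℝ} (hM : MeasurableSet M) (ψ : E) :
    P M (P M ψ) = P M ψ := by
  rw [hP.inter_apply hM hM, Set.inter_self]

theorem empty (hP : IsSpectralMeasure A P) : P ∅ = 0 := by
  ext ψ
  obtain ⟨μ, h, -⟩ := hP.integral ψ
  have := h ∅ MeasurableSet.empty
  rw [measure_empty, eq_comm, ENNReal.ofReal_eq_zero] at this
  have h2 : ‖P ∅ ψ‖ = 0 := by nlinarith [norm_nonneg (P ∅ ψ)]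
  simpa using h2

theorem norm_sq_add_compl (hP : IsSpectralMeasure A P) {M : Set ℝ} (hM : MeasurableSet M)
    (ψ : E) : ‖P M ψ‖ ^ 2 + ‖P Mᶜ ψ‖ ^ 2 = ‖ψ‖ ^ 2 := by
  obtain ⟨μ, h, -⟩ := hP.integral ψ
  have h1 := measure_add_measure_compl (μ := μ) hM
  rw [h _ hM, h _ hM.compl, h _ MeasurableSet.univ, hP.univ, ← ENNReal.ofReal_add (by positivity)
    (by positivity), ENNReal.ofReal_eq_ofReal_iff (by positivity) (by positivity)] at h1
  exact h1

/-- Countable additivity is given only for the squared norms, so additivity of vectors has to be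
recovered: the squared norm of the difference of the two sides expands to zero. -/
theorem apply_compl (hP : IsSpectralMeasure A P) {M : Set ℝ} (hM : MeasurableSet M) (ψ : E) :
    P Mᶜ ψ = ψ - P M ψ := by
  have h : P Mᶜ (ψ - P M ψ) = P Mᶜ ψ := by
    rw [map_sub, hP.inter_apply hM.compl hM, Set.compl_inter_self, hP.empty]
    simp
  have h2 := hP.norm_sq_add_compl hM.compl (ψ - P M ψ)
  have h3 : P M (ψ - P M ψ) = 0 := by rw [map_sub, hP.self_apply hM, sub_self]
  have h4 := hP.norm_sq_add_compl hM ψ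
  have h5 : ‖P Mᶜ ψ - (ψ - P M ψ)‖ ^ 2 = 0 := by
    have h6 : inner ℂ (ψ - P M ψ) (P Mᶜ ψ) = ((‖P Mᶜ ψ‖ ^ 2 : ℝ) : ℂ) := by
      rw [inner_sub_left, inner_starProjection_left (hP.isStarProjection M hM),
        hP.inter_apply hM hM.compl, Set.inter_compl_self, hP.empty]
      simpa using norm_sq_starProjection (hP.isStarProjection _ hM.compl) ψ
    rw [h, compl_compl, h3, norm_zero] at h2
    rw [norm_sub_rev, @norm_sub_sq ℂ, h6]
    simp only [RCLike.re_to_complex, Complex.ofReal_re]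
    linarith
  rw [← sub_eq_zero]
  simpa using h5

/-- The spectral measure of `P M ψ` is the restriction of that of `ψ` to `M`. -/
theorem eq_restrict (hP : IsSpectralMeasure A P) {M : Set ℝ} (hM : MeasurableSet M) {ψ : E}
    {μ ν : Measure ℝ} (hμ : ∀ N, MeasurableSet N → μ N = ENNReal.ofReal (‖P N ψ‖ ^ 2))
    (hν : ∀ N, MeasurableSet N → ν N = ENNReal.ofReal (‖P N (P M ψ)‖ ^ 2)) :
    ν = μ.restrict M := by
  ext N hN
  rw [Measure.restrict_apply hN, hν N hN, hμ _ (hN.inter hM), hP.inter_apply hN hM]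

theorem isFiniteMeasure {ψ : E} {μ : Measure ℝ}
    (hμ : ∀ N, MeasurableSet N → μ N = ENNReal.ofReal (‖P N ψ‖ ^ 2)) : IsFiniteMeasure μ :=
  ⟨by rw [hμ _ MeasurableSet.univ]; exact ENNReal.ofReal_lt_top⟩

theorem apply_mem_domain (hP : IsSpectralMeasure A P) {M : Set ℝ} (hM : MeasurableSet M) {ψ : E}
    (h : ψ ∈ A.domain) : P M ψ ∈ A.domain := by
  obtain ⟨μ, hμ, h2, -⟩ := hP.integral ψ
  obtain ⟨ν, hν, h4, -⟩ := hP.integral (P M ψ)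
  rw [h4, hP.eq_restrict hM hμ hν]
  exact (lintegral_mono' Measure.restrict_le_self le_rfl).trans_lt (h2.1 h)

theorem integrable_id {μ : Measure ℝ} [IsFiniteMeasure μ]
    (h : ∫⁻ t, ENNReal.ofReal (t ^ 2) ∂μ < ⊤) : Integrable (fun t : ℝ => t) μ := by
  have h2 : Integrable (fun t : ℝ => t ^ 2) μ := by
    refine ⟨by fun_prop, ?_⟩
    rw [hasFiniteIntegral_iff_ofReal (Filter.Eventually.of_forall fun t => sq_nonneg t)]
    exact h
  refine (h2.add (integrable_const 1)).mono' (by fun_prop) (Filter.Eventually.of_forall fun t => ?_)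
  rw [Real.norm_eq_abs, Pi.add_apply]
  nlinarith [sq_abs t, sq_nonneg (|t| - 1)]

theorem inner_apply_split (hP : IsSpectralMeasure A P) {M : Set ℝ} (hM : MeasurableSet M) {ψ : E}
    (h : ψ ∈ A.domain) : inner ℂ ψ (A ⟨ψ, h⟩) =
      inner ℂ (P M ψ) (A ⟨P M ψ, hP.apply_mem_domain hM h⟩) +
      inner ℂ (P Mᶜ ψ) (A ⟨P Mᶜ ψ, hP.apply_mem_domain hM.compl h⟩) := by
  obtain ⟨μ, hμ, h2, h3⟩ := hP.integral ψ
  obtain ⟨ν, hν, -, h4⟩ := hP.integral (P M ψ)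
  obtain ⟨ν', hν', -, h5⟩ := hP.integral (P Mᶜ ψ)
  rw [h3 h, h4, h5, hP.eq_restrict hM hμ hν, hP.eq_restrict hM.compl hμ hν', ← Complex.ofReal_add]
  have := isFiniteMeasure hμ
  rw [integral_add_compl hM (integrable_id (h2.1 h))]

/-- The form of `A` vanishes between the ranges of complementary spectral projections. -/
theorem inner_apply_eq_zero (hP : IsSpectralMeasure A P) {M : Set ℝ} (hM : MeasurableSet M)
    {u v : E} (hu : u ∈ A.domain) (hv : v ∈ A.domain) (hu' : P M u = u) (hv' : P M v = 0) :
    inner ℂ u (A ⟨v, hv⟩) = 0 := by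
  -- The quadratic form at u + z v splits along M and its complement, so the cross terms cancel; z =
  -- 1 and z = i separate them.
  have key : ∀ z : ℂ, z * inner ℂ u (A ⟨v, hv⟩) + starRingEnd ℂ z * inner ℂ v (A ⟨u, hu⟩) = 0 := by
    intro z
    have hw : u + z • v ∈ A.domain := A.domain.add_mem hu (A.domain.smul_mem z hv)
    have e1 : P M (u + z • v) = u := by rw [map_add, map_smul, hu', hv', smul_zero, add_zero]
    have e2 : P Mᶜ (u + z • v) = z • v := by rw [hP.apply_compl hM, e1, add_sub_cancel_left]
    have h := hP.inner_apply_split hM hw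
    have ha : A ⟨u + z • v, hw⟩ = A ⟨u, hu⟩ + z • A ⟨v, hv⟩ := by
      rw [← A.map_smul, ← A.map_add]; rfl
    have hb : A ⟨P M (u + z • v), hP.apply_mem_domain hM hw⟩ = A ⟨u, hu⟩ := by congr 2
    have hc : A ⟨P Mᶜ (u + z • v), hP.apply_mem_domain hM.compl hw⟩ = z • A ⟨v, hv⟩ := by
      rw [← A.map_smul]; congr 2
    rw [ha, hb, hc, e1, e2] at h
    simp only [inner_add_left, inner_add_right, inner_smul_left, inner_smul_right] at h
    linear_combination h
  have h1 := key 1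
  have h2 := key Complex.I
  simp only [map_one, one_mul, Complex.conj_I] at h1 h2
  have h3 : (2 * Complex.I) * inner ℂ u (A ⟨v, hv⟩) = 0 := by
    linear_combination h2 + Complex.I * h1
  simpa using h3

theorem mem_domain_of_apply_Icc (hP : IsSpectralMeasure A P) (c r : ℝ) {u : E}
    (hu : P (Set.Icc (c - r) (c + r)) u = u) : u ∈ A.domain := by
  obtain ⟨μ, hμ, h2, -⟩ := hP.integral u
  have e := hP.eq_restrict (M := Set.Icc (c - r) (c + r)) measurableSet_Icc hμ (ν := μ)
    (by rw [hu]; exact hμ)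
  have := isFiniteMeasure hμ
  rw [h2, e]
  refine (setLIntegral_mono (g := fun _ => ENNReal.ofReal ((|c| + |r|) ^ 2)) measurable_const
    fun t ht => ENNReal.ofReal_le_ofReal ?_).trans_lt ?_
  · rw [sq_le_sq, abs_of_nonneg (by positivity : 0 ≤ |c| + |r|), abs_le]
    constructor <;>
    cases abs_cases c <;> cases abs_cases r <;> linarith [ht.1, ht.2]
  · rw [lintegral_const]
    exact ENNReal.mul_lt_top ENNReal.ofReal_lt_top (measure_lt_top _ _)

theorem abs_inner_sub_le (hP : IsSpectralMeasure A P) {c r : ℝ} {u : E}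
    (hu : P (Set.Icc (c - r) (c + r)) u = u) (h : u ∈ A.domain) :
    ∃ x : ℝ, inner ℂ u (A ⟨u, h⟩ - (c : ℂ) • u) = x ∧ |x| ≤ r * ‖u‖ ^ 2 := by
  obtain ⟨μ, hμ, h2, h3⟩ := hP.integral u
  have e := hP.eq_restrict (M := Set.Icc (c - r) (c + r)) measurableSet_Icc hμ (ν := μ)
    (by rw [hu]; exact hμ)
  have := isFiniteMeasure hμ
  have hi := integrable_id (h2.1 h)
  have hm : μ.real Set.univ = ‖u‖ ^ 2 := by
    rw [Measure.real, hμ _ MeasurableSet.univ, hP.univ, ENNReal.toReal_ofReal (by positivity)]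
    rfl
  refine ⟨∫ t, (t - c) ∂μ, ?_, ?_⟩
  · rw [inner_sub_right, h3 h, inner_smul_right, inner_self_eq_norm_sq_to_K,
      integral_sub hi (integrable_const c), integral_const, hm, smul_eq_mul]
    push_cast
    ring_nf
    simp
  · rw [← Real.norm_eq_abs, ← hm]
    refine norm_integral_le_of_norm_le_const ?_
    rw [e]
    filter_upwards [ae_restrict_mem measurableSet_Icc] with t ht
    rw [Real.norm_eq_abs, abs_le]
    constructor <;> linarith [ht.1, ht.2]

/-- `P [c - r, c + r]` cuts `A - c` down to norm `r`. -/
theorem norm_apply_sub_le (hP : IsSpectralMeasure A P) {c r : ℝ} {χ : E} (h : χ ∈ A.domain) :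
    ‖P (Set.Icc (c - r) (c + r)) (A ⟨χ, h⟩ - (c : ℂ) • χ)‖ ≤
      r * ‖P (Set.Icc (c - r) (c + r)) χ‖ := by
  set J := Set.Icc (c - r) (c + r)
  have hJ : MeasurableSet J := measurableSet_Icc
  set u := P J χ with hu
  have huu : P J u = u := hP.self_apply hJ χ
  have hud : u ∈ A.domain := hP.apply_mem_domain hJ h
  set w := P J (A ⟨χ, h⟩ - (c : ℂ) • χ) with hw
  have hww : P J w = w := hP.self_apply hJ _
  have hwd : w ∈ A.domain := hP.mem_domain_of_apply_Icc c r hww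
  have hinner : ∀ (v : E) (hv : v ∈ A.domain), P J v = v →
      inner ℂ v (A ⟨χ, h⟩ - (c : ℂ) • χ) = inner ℂ v (A ⟨u, hud⟩ - (c : ℂ) • u) := by
    intro v hv hvv
    have hd : χ - u ∈ A.domain := A.domain.sub_mem h hud
    have h0 := hP.inner_apply_eq_zero hJ hv hd hvv (by rw [map_sub, huu, hu, sub_self])
    have h1 : A ⟨χ - u, hd⟩ = A ⟨χ, h⟩ - A ⟨u, hud⟩ := by rw [← A.map_sub]; rfl
    have h2 : inner ℂ v χ = inner ℂ v u := by
      conv_lhs => rw [← hvv]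
      rw [inner_starProjection_left (hP.isStarProjection J hJ)]
    rw [h1, inner_sub_right, sub_eq_zero] at h0
    rw [inner_sub_right, inner_sub_right, inner_smul_right, inner_smul_right, h0, h2]
  have hwT : ∀ v, P J v = v → inner ℂ v w = inner ℂ v (A ⟨u, hud⟩ - (c : ℂ) • u) := by
    intro v hvv
    rw [hw, ← inner_starProjection_left (hP.isStarProjection J hJ), hvv]
    exact hinner v (hP.mem_domain_of_apply_Icc c r hvv) hvv
  -- the form `T` of `A - c` on `ran P J`
  have hquad : ∀ s : ℝ, 2 * s * ‖w‖ ^ 2 ≤ r * (s ^ 2 * ‖w‖ ^ 2 + ‖u‖ ^ 2) := by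
    intro s
    have hsd (s : ℝ) : u + (s : ℂ) • w ∈ A.domain := A.domain.add_mem hud (A.domain.smul_mem _ hwd)
    have hsP (s : ℝ) : P J (u + (s : ℂ) • w) = u + (s : ℂ) • w := by
      rw [map_add, map_smul, huu, hww]
    obtain ⟨x, hx, hx'⟩ := hP.abs_inner_sub_le (hsP s) (hsd s)
    obtain ⟨y, hy, hy'⟩ := hP.abs_inner_sub_le (hsP (-s)) (hsd (-s))
    obtain ⟨x0, hx0, -⟩ := hP.abs_inner_sub_le (hsP 0) (hsd 0)
    obtain ⟨xw, hxw, -⟩ := hP.abs_inner_sub_le hww hwd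
    have ha (s : ℝ) : A ⟨u + (s : ℂ) • w, hsd s⟩ = A ⟨u, hud⟩ + (s : ℂ) • A ⟨w, hwd⟩ := by
      rw [← A.map_smul, ← A.map_add]; rfl
    have hexp (s : ℝ) : inner ℂ (u + (s : ℂ) • w) (A ⟨u + (s : ℂ) • w, hsd s⟩ -
        (c : ℂ) • (u + (s : ℂ) • w)) = inner ℂ u (A ⟨u, hud⟩ - (c : ℂ) • u) +
        s * (inner ℂ u (A ⟨w, hwd⟩ - (c : ℂ) • w) + inner ℂ w (A ⟨u, hud⟩ - (c : ℂ) • u)) +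
        s ^ 2 * inner ℂ w (A ⟨w, hwd⟩ - (c : ℂ) • w) := by
      rw [ha]
      simp only [inner_add_left, inner_add_right, inner_sub_right, inner_smul_left,
        inner_smul_right, Complex.conj_ofReal]
      ring
    have hwu : inner ℂ w (A ⟨u, hud⟩ - (c : ℂ) • u) = ((‖w‖ ^ 2 : ℝ) : ℂ) := by
      rw [← hwT w hww, inner_self_eq_norm_sq_to_K]
      norm_cast
    have hre : (inner ℂ u (A ⟨w, hwd⟩ - (c : ℂ) • w)).re = ‖w‖ ^ 2 := by
      -- symmetry of the form, from its reality on the diagonal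
      have hz : u + Complex.I • w ∈ A.domain :=
        A.domain.add_mem hud (A.domain.smul_mem _ hwd)
      have hzP : P J (u + Complex.I • w) = u + Complex.I • w := by
        rw [map_add, map_smul, huu, hww]
      obtain ⟨z, hz1, -⟩ := hP.abs_inner_sub_le hzP hz
      have haz : A ⟨u + Complex.I • w, hz⟩ = A ⟨u, hud⟩ + Complex.I • A ⟨w, hwd⟩ := by
        rw [← A.map_smul, ← A.map_add]; rfl
      have hexpz : inner ℂ (u + Complex.I • w) (A ⟨u + Complex.I • w, hz⟩ -
          (c : ℂ) • (u + Complex.I • w)) = inner ℂ u (A ⟨u, hud⟩ - (c : ℂ) • u) +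
          Complex.I * (inner ℂ u (A ⟨w, hwd⟩ - (c : ℂ) • w) -
            inner ℂ w (A ⟨u, hud⟩ - (c : ℂ) • u)) +
          inner ℂ w (A ⟨w, hwd⟩ - (c : ℂ) • w) := by
        rw [haz]
        simp only [inner_add_left, inner_add_right, inner_sub_right, inner_smul_left,
          inner_smul_right, Complex.conj_I]
        linear_combination (-(inner ℂ w (A ⟨w, hwd⟩) - (c : ℂ) * inner ℂ w w)) * Complex.I_sq
      have h0 := hexp 0
      rw [hx0] at h0
      simp only [Complex.ofReal_zero, zero_mul, add_zero, zero_pow two_ne_zero] at h0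
      rw [hz1, hwu, ← h0, hxw] at hexpz
      have := congrArg Complex.im hexpz
      simp only [Complex.ofReal_im, Complex.add_im, Complex.mul_im, Complex.I_re, Complex.I_im,
        Complex.sub_re, Complex.ofReal_re, Complex.sub_im, zero_mul, one_mul] at this
      linarith
    have h1 := congrArg Complex.re (hexp s)
    have h2 := congrArg Complex.re (hexp (-s))
    rw [hx, hwu, hxw] at h1
    rw [hy, hwu, hxw] at h2
    simp only [Complex.add_re, Complex.re_ofReal_mul, Complex.ofReal_re, hre,
      ← Complex.ofReal_pow] at h1 h2
    -- The difference of the forms at u + s w and u - s w is 4s‖w‖², while each is bounded by r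
    -- times the squared norm; the parallelogram law adds these bounds. This is the argument that a
    -- symmetric form is bounded by its numerical radius.
    have hn := @parallelogram_law_with_norm ℂ E _ _ _ u ((s : ℂ) • w)
    rw [norm_smul, Complex.norm_real, Real.norm_eq_abs, mul_pow, sq_abs] at hn
    have hn' := congrArg (r * ·) hn
    simp only [mul_add] at hn'
    rw [Complex.ofReal_neg, neg_smul, ← sub_eq_add_neg] at hy'
    have h4 := (abs_le.1 hx').2
    have h5 := (abs_le.1 hy').1
    linarith
  by_cases hw0 : ‖w‖ = 0
  · have h1 := hquad 1
    rw [hw0]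
    by_cases hu0 : ‖u‖ = 0
    · rw [hu0, mul_zero]
    · have : 0 < ‖u‖ := lt_of_le_of_ne (norm_nonneg _) (Ne.symm hu0)
      rw [hw0] at h1
      have : 0 ≤ r := by
        by_contra! hr
        nlinarith [mul_pos this this]
      positivity
  · have hwp : 0 < ‖w‖ := lt_of_le_of_ne (norm_nonneg _) (Ne.symm hw0)
    -- The optimal s. For u ≠ 0 it gives ‖w‖ ≤ r‖u‖ after division; u = 0 would force ‖w‖² = ⟪w, (A
    -- - c)u⟫ = 0.
    have h1 := hquad (‖u‖ / ‖w‖)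
    have h2 : 2 * (‖u‖ / ‖w‖) * ‖w‖ ^ 2 = 2 * (‖u‖ * ‖w‖) := by field_simp
    have h3 : (‖u‖ / ‖w‖) ^ 2 * ‖w‖ ^ 2 = ‖u‖ ^ 2 := by field_simp
    rw [h2, h3] at h1
    by_cases hu0 : ‖u‖ = 0
    · have h6 := inner_self_eq_norm_sq_to_K (𝕜 := ℂ) w
      rw [hwT w hww] at h6
      have hu00 : u = 0 := norm_eq_zero.1 hu0
      have h7 : A ⟨u, hud⟩ = 0 := by
        rw [← A.map_zero]
        congr 2
      rw [h7, hu00] at h6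
      simp at h6
      exact absurd (by exact_mod_cast (pow_eq_zero_iff two_ne_zero).1 h6.symm) hw0
    · have hup : 0 < ‖u‖ := lt_of_le_of_ne (norm_nonneg _) (Ne.symm hu0)
      nlinarith

end IsSpectralMeasure

namespace IsBorelCalculus

variable {A : E →ₗ.[ℂ] E} {Φ : (ℝ → ℂ) → E →L[ℂ] E}

theorem isStarProjection_indicator (hΦ : IsBorelCalculus A Φ) {M : Set ℝ} (hM : MeasurableSet M) :
    IsStarProjection (Φ (M.indicator fun _ => 1)) := by
  refine ⟨?_, ?_⟩
  · rw [IsIdempotentElem, ← hΦ.map_mul _ _ (.indicator hM) (.indicator hM)]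
    congr 1; funext t
    by_cases h : t ∈ M <;> simp [h]
  · rw [IsSelfAdjoint, ← hΦ.map_star _ (.indicator hM)]
    congr 1; funext t
    by_cases h : t ∈ M <;> simp [h]

theorem measure_eq (hΦ : IsBorelCalculus A Φ) {ψ : E} {μ : Measure ℝ} [IsFiniteMeasure μ]
    (hμ : ∀ g, IsBoundedBorel g → inner ℂ ψ (Φ g ψ) = ∫ t, g t ∂μ) {M : Set ℝ}
    (hM : MeasurableSet M) : μ M = ENNReal.ofReal (‖Φ (M.indicator fun _ => 1) ψ‖ ^ 2) := by
  have h := hμ _ (.indicator hM)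
  rw [norm_sq_starProjection (hΦ.isStarProjection_indicator hM), integral_indicator_const _ hM,
    Complex.real_smul, mul_one] at h
  rw [Complex.ofReal_injective h, ofReal_measureReal]

theorem isSpectralMeasure (hΦ : IsBorelCalculus A Φ) :
    IsSpectralMeasure A fun M => Φ (M.indicator fun _ => 1) where
  isStarProjection M hM := hΦ.isStarProjection_indicator hM
  univ := by simpa using hΦ.map_one
  inter M N hM hN := by
    rw [← hΦ.map_mul _ _ (.indicator hM) (.indicator hN)]
    congr 1; funext t
    by_cases h : t ∈ M <;> by_cases h' : t ∈ N <;> simp [h, h']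
  integral ψ := by
    obtain ⟨μ, h1, h2, h3⟩ := hΦ.measure ψ
    exact ⟨μ, fun M hM => hΦ.measure_eq h2 hM, h3⟩

theorem norm_apply_le (hΦ : IsBorelCalculus A Φ) {g : ℝ → ℂ} (hg : IsBoundedBorel g) {C : ℝ}
    (hC : ∀ t, ‖g t‖ ≤ C) (ψ : E) : ‖Φ g ψ‖ ≤ C * ‖ψ‖ := by
  have hC0 : 0 ≤ C := (norm_nonneg _).trans (hC 0)
  obtain ⟨μ, h1, h2, -⟩ := hΦ.measure ψ
  have e0 : μ.real Set.univ = ‖ψ‖ ^ 2 := by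
    have := h2 _ (.const 1)
    rw [hΦ.map_one, one_apply_eq_self, inner_self_eq_norm_sq_to_K] at this
    simp at this
    exact_mod_cast this.symm
  have e1 : ((‖Φ g ψ‖ ^ 2 : ℝ) : ℂ) = ∫ t, star (g t) * g t ∂μ := by
    rw [← h2 _ (hg.star.mul hg), hΦ.map_mul _ _ hg.star hg, hΦ.map_star _ hg,
      mul_apply_eq_comp, ContinuousLinearMap.star_eq_adjoint,
      ContinuousLinearMap.adjoint_inner_right, inner_self_eq_norm_sq_to_K]
    norm_cast
  have e2 : ‖Φ g ψ‖ ^ 2 ≤ C ^ 2 * ‖ψ‖ ^ 2 := by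
    rw [← e0, ← abs_of_nonneg (sq_nonneg ‖Φ g ψ‖), ← Real.norm_eq_abs, ← Complex.norm_real, e1]
    refine norm_integral_le_of_norm_le_const (Filter.Eventually.of_forall fun t => ?_)
    rw [norm_mul, norm_star, sq]
    exact mul_le_mul (hC t) (hC t) (norm_nonneg _) hC0
  rw [← mul_pow] at e2
  exact (pow_le_pow_iff_left₀ (norm_nonneg _) (by positivity) two_ne_zero).1 e2

end IsBorelCalculus

end Hilbert

section Hilbert

variable {E : Type*} [NormedAddCommGroup E] [InnerProductSpace ℂ E] [CompleteSpace E]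

namespace IsSpectralMeasure

variable {A : E →ₗ.[ℂ] E} {P : Set ℝ → E →L[ℂ] E}

theorem apply_eq_zero_iff {ψ : E} {μ : Measure ℝ}
    (hμ : ∀ N, MeasurableSet N → μ N = ENNReal.ofReal (‖P N ψ‖ ^ 2)) {M : Set ℝ}
    (hM : MeasurableSet M) : P M ψ = 0 ↔ μ M = 0 := by
  rw [hμ M hM, ENNReal.ofReal_eq_zero]
  constructor
  · intro h; simp [h]
  · intro h
    have : ‖P M ψ‖ ^ 2 = 0 := le_antisymm h (sq_nonneg _)
    simpa using this

theorem apply_iUnion_eq_zero (hP : IsSpectralMeasure A P) {M : ℕ → Set ℝ}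
    (hM : ∀ m, MeasurableSet (M m)) {ψ : E} (h : ∀ m, P (M m) ψ = 0) : P (⋃ m, M m) ψ = 0 := by
  obtain ⟨μ, hμ, -⟩ := hP.integral ψ
  rw [apply_eq_zero_iff hμ (.iUnion hM), measure_iUnion_null_iff]
  exact fun m => (apply_eq_zero_iff hμ (hM m)).1 (h m)

theorem mul_eq_zero_symm {Q : Set ℝ → E →L[ℂ] E} (hP : IsSpectralMeasure A P)
    (hQ : IsSpectralMeasure A Q) {M N : Set ℝ} (hM : MeasurableSet M) (hN : MeasurableSet N)
    (h : ∀ ψ, P M (Q N ψ) = 0) (ψ : E) : Q N (P M ψ) = 0 := by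
  rw [← inner_self_eq_zero (𝕜 := ℂ), inner_starProjection_left (hQ.isStarProjection N hN),
    inner_starProjection_left (hP.isStarProjection M hM), hQ.self_apply hN, h, inner_zero_right]

end IsSpectralMeasure

namespace IsBorelCalculus

variable {A : E →ₗ.[ℂ] E} {Φ : (ℝ → ℂ) → E →L[ℂ] E}

/-- Spectral projections of the same operator onto separated sets annihilate each other. -/
theorem apply_Icc_eq_zero (hΦ : IsBorelCalculus A Φ) {P : Set ℝ → E →L[ℂ] E}
    (hP : IsSpectralMeasure A P) {c r δ : ℝ} (hr : 0 ≤ r) (hδ : 0 < δ) {M : Set ℝ}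
    (hM : MeasurableSet M) (hsep : ∀ t ∈ M, r + δ ≤ |t - c|) (ψ : E) :
    P (Set.Icc (c - r) (c + r)) (Φ (M.indicator fun _ => 1) ψ) = 0 := by
  set J := Set.Icc (c - r) (c + r)
  set B : E →L[ℂ] E := P J * Φ (M.indicator fun _ => 1) with hB
  have hpos : 0 < r + δ := by linarith
  set g : ℝ → ℂ := M.indicator fun t => ((t : ℂ) - c)⁻¹ with hg
  have hgb : ∀ t, ‖g t‖ ≤ (r + δ)⁻¹ := by
    intro t
    by_cases ht : t ∈ M
    · rw [hg, Set.indicator_of_mem ht, norm_inv, ← Complex.ofReal_sub, Complex.norm_real]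
      exact inv_anti₀ hpos (hsep t ht)
    · rw [hg, Set.indicator_of_notMem ht, norm_zero]
      positivity
  have hgB : IsBoundedBorel g := ⟨Measurable.indicator (by fun_prop) hM, _, hgb⟩
  have e1 : (fun t : ℝ => ((t : ℂ) - c) * g t) = M.indicator fun _ => 1 := by
    funext t
    by_cases ht : t ∈ M
    · have h0 : (t : ℂ) - c ≠ 0 := by
        rw [← Complex.ofReal_sub, Ne, Complex.ofReal_eq_zero]
        intro h0
        have := hsep t ht
        rw [h0, abs_zero] at this
        linarith
      rw [hg, Set.indicator_of_mem ht, Set.indicator_of_mem ht, mul_inv_cancel₀ h0]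
    · rw [hg, Set.indicator_of_notMem ht, Set.indicator_of_notMem ht, mul_zero]
  have e2 : Φ g = Φ (M.indicator fun _ => 1) * Φ g := by
    rw [← hΦ.map_mul _ _ (.indicator hM) hgB]
    congr 1; funext t
    by_cases ht : t ∈ M <;> simp [hg, ht]
  -- Since (A - c) Φ(g) φ is the projection of φ onto M, B φ is P J (A - c) Φ(g) φ. On the range of
  -- P J the operator A - c gains at most r, while Φ(g) has norm at most 1/(r + δ). The resulting
  -- factor is below 1, so ‖B‖ = 0.
  have hbound : ∀ φ, ‖B φ‖ ≤ (r * (r + δ)⁻¹ * ‖B‖) * ‖φ‖ := by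
    intro φ
    obtain ⟨hd, hA⟩ := hΦ.apply_sub c g hgB (by rw [e1]; exact .indicator hM) φ
    rw [e1] at hA
    have h1 := hP.norm_apply_sub_le (c := c) (r := r) hd
    rw [hA] at h1
    have h2 : P J (Φ g φ) = B (Φ g φ) := by
      conv_lhs => rw [e2]
      rfl
    calc ‖B φ‖ ≤ r * ‖B (Φ g φ)‖ := by rw [← h2]; exact h1
      _ ≤ r * (‖B‖ * ((r + δ)⁻¹ * ‖φ‖)) := by
        gcongr
        exact (B.le_opNorm _).trans (by gcongr; exact hΦ.norm_apply_le hgB hgb φ)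
      _ = _ := by ring
  have hq : r * (r + δ)⁻¹ < 1 := by
    rw [← div_eq_mul_inv, div_lt_one hpos]
    linarith
  have h3 := B.opNorm_le_bound (by positivity) hbound
  have h4 : ‖B‖ = 0 := by nlinarith [norm_nonneg B]
  have h5 : B = 0 := norm_eq_zero.1 h4
  change B ψ = 0
  rw [h5]; rfl

theorem apply_Iic_Ici_eq_zero (hΦ : IsBorelCalculus A Φ) {P : Set ℝ → E →L[ℂ] E}
    (hP : IsSpectralMeasure A P) {x y : ℝ} (hxy : x < y) (ψ : E) :
    P (Set.Iic x) (Φ ((Set.Ici y).indicator fun _ => 1) ψ) = 0 := by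
  -- Intervals of growing radius with common right endpoint x, so the gap to [y, ∞) stays y - x.
  have hU : Set.Iic x = ⋃ m : ℕ, Set.Icc ((x - m) - m) ((x - m) + m) := by
    ext t
    simp only [Set.mem_Iic, Set.mem_iUnion, Set.mem_Icc]
    constructor
    · intro h
      obtain ⟨m, hm⟩ := exists_nat_ge ((x - t) / 2)
      exact ⟨m, by linarith, by linarith⟩
    · rintro ⟨m, -, h⟩; linarith
  rw [hU]
  refine hP.apply_iUnion_eq_zero (fun m => measurableSet_Icc) fun m =>
    hΦ.apply_Icc_eq_zero hP (Nat.cast_nonneg m) (sub_pos.2 hxy) measurableSet_Ici (fun t ht => ?_) ψ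
  rw [Set.mem_Ici] at ht
  rw [le_abs]
  left; linarith

theorem apply_Ici_Iic_eq_zero (hΦ : IsBorelCalculus A Φ) {P : Set ℝ → E →L[ℂ] E}
    (hP : IsSpectralMeasure A P) {x y : ℝ} (hxy : x < y) (ψ : E) :
    P (Set.Ici y) (Φ ((Set.Iic x).indicator fun _ => 1) ψ) = 0 := by
  have hU : Set.Ici y = ⋃ m : ℕ, Set.Icc ((y + m) - m) ((y + m) + m) := by
    ext t
    simp only [Set.mem_Ici, Set.mem_iUnion, Set.mem_Icc]
    constructor
    · intro h
      obtain ⟨m, hm⟩ := exists_nat_ge ((t - y) / 2)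
      exact ⟨m, by linarith, by linarith⟩
    · rintro ⟨m, h, -⟩; linarith
  rw [hU]
  refine hP.apply_iUnion_eq_zero (fun m => measurableSet_Icc) fun m =>
    hΦ.apply_Icc_eq_zero hP (Nat.cast_nonneg m) (sub_pos.2 hxy) measurableSet_Iic (fun t ht => ?_) ψ
  rw [Set.mem_Iic] at ht
  rw [le_abs]
  right; linarith

theorem Ioi_eq_iUnion (x : ℝ) : Set.Ioi x = ⋃ m : ℕ, Set.Ici (x + 1 / ((m : ℝ) + 1)) := by
  ext t
  simp only [Set.mem_Ioi, Set.mem_iUnion, Set.mem_Ici]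
  constructor
  · intro h
    obtain ⟨m, hm⟩ := exists_nat_one_div_lt (sub_pos.2 h)
    exact ⟨m, by linarith⟩
  · rintro ⟨m, hm⟩
    have : (0 : ℝ) < 1 / ((m : ℝ) + 1) := by positivity
    linarith

/-- Uniqueness of the spectral projections onto half-lines. -/
theorem Iic_eq_of_isSpectralMeasure (hΦ : IsBorelCalculus A Φ) {P : Set ℝ → E →L[ℂ] E}
    (hP : IsSpectralMeasure A P) (x : ℝ) :
    P (Set.Iic x) = Φ ((Set.Iic x).indicator fun _ => 1) := by
  have hQ := hΦ.isSpectralMeasure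
  set Q : Set ℝ → E →L[ℂ] E := fun M => Φ (M.indicator fun _ => 1)
  have hpos (m : ℕ) : x < x + 1 / ((m : ℝ) + 1) := by
    have : (0 : ℝ) < 1 / ((m : ℝ) + 1) := by positivity
    linarith
  -- The two half-lines touch, so the separated case is used on [x + 1/(m+1), ∞) and exhausted by
  -- countable additivity. Together with `h2` this yields P = PQ and Q = PQ on (-∞, x].
  have h1 : ∀ ψ, Q (Set.Ioi x) (P (Set.Iic x) ψ) = 0 := by
    intro ψ
    rw [Ioi_eq_iUnion]
    exact hQ.apply_iUnion_eq_zero (fun m => measurableSet_Ici) fun m =>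
      hP.mul_eq_zero_symm hQ measurableSet_Iic measurableSet_Ici
        (hΦ.apply_Iic_Ici_eq_zero hP (hpos m)) ψ
  have h2 : ∀ ψ, P (Set.Ioi x) (Q (Set.Iic x) ψ) = 0 := by
    intro ψ
    rw [Ioi_eq_iUnion]
    exact hP.apply_iUnion_eq_zero (fun m => measurableSet_Ici) fun m =>
      hΦ.apply_Ici_Iic_eq_zero hP (hpos m) ψ
  have h3 := hQ.mul_eq_zero_symm hP measurableSet_Ioi measurableSet_Iic h1
  ext ψ
  have h4 := h2 ψ
  have h5 := h3 ψ
  rw [← Set.compl_Iic] at h4 h5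
  rw [hP.apply_compl measurableSet_Iic] at h4
  rw [hQ.apply_compl measurableSet_Iic, map_sub] at h5
  change P _ ψ = Q _ ψ
  rw [sub_eq_zero] at h4 h5
  rw [h5, ← h4]

theorem spectralProjection_Iic (hΦ : IsBorelCalculus A Φ) (x : ℝ) :
    spectralProjection A (Set.Iic x) = Φ ((Set.Iic x).indicator fun _ => 1) := by
  have h : ∃ P, IsSpectralMeasure A P := ⟨_, hΦ.isSpectralMeasure⟩
  rw [spectralProjection, dif_pos h]
  exact hΦ.Iic_eq_of_isSpectralMeasure h.choose_spec x

end IsBorelCalculus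

/-! ### Traces against a density matrix through its square root. -/

section Trace

theorem hasSum_norm_sq_inner {ι : Type*} (b : HilbertBasis ι ℂ E) (v : E) :
    HasSum (fun j => ‖inner ℂ (b j) v‖ ^ 2) (‖v‖ ^ 2) := by
  have h := b.hasSum_inner_mul_inner v v
  rw [inner_self_eq_norm_sq_to_K] at h
  have e : (fun j => inner ℂ v (b j) * inner ℂ (b j) v) =
      fun j => ((‖inner ℂ (b j) v‖ ^ 2 : ℝ) : ℂ) := by
    funext j
    rw [← inner_conj_symm, ← Complex.normSq_eq_conj_mul_self, Complex.normSq_eq_norm_sq]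
  rw [e] at h
  refine Complex.hasSum_ofReal.1 ?_
  rw [Complex.ofReal_pow]
  exact h

theorem tsum_norm_sq_inner_ofReal {ι : Type*} (b : HilbertBasis ι ℂ E) (v : E) :
    ∑' j, ENNReal.ofReal (‖inner ℂ (b j) v‖ ^ 2) = ENNReal.ofReal (‖v‖ ^ 2) := by
  rw [← ENNReal.ofReal_tsum_of_nonneg (fun _ => sq_nonneg _) (hasSum_norm_sq_inner b v).summable,
    (hasSum_norm_sq_inner b v).tsum_eq]

/-- The positive square root of a positive operator. -/
def opSqrt (ρ : E →L[ℂ] E) : E →L[ℂ] E := CFC.sqrt ρ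

theorem opSqrt_apply_apply {ρ : E →L[ℂ] E} (hρ : ρ.IsPositive) (v : E) :
    opSqrt ρ (opSqrt ρ v) = ρ v := by
  have := CFC.sqrt_mul_sqrt_self ρ ((ContinuousLinearMap.nonneg_iff_isPositive ρ).2 hρ)
  conv_rhs => rw [← this]
  rfl

theorem inner_opSqrt_left (ρ : E →L[ℂ] E) (v w : E) :
    inner ℂ (opSqrt ρ v) w = inner ℂ v (opSqrt ρ w) := by
  have h : IsSelfAdjoint (opSqrt ρ) := (CFC.sqrt_nonneg ρ).isSelfAdjoint
  rw [← ContinuousLinearMap.adjoint_inner_left, ← ContinuousLinearMap.star_eq_adjoint, h.star_eq]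

theorem inner_apply_eq_norm_sq_opSqrt {ρ : E →L[ℂ] E} (hρ : ρ.IsPositive) (v : E) :
    inner ℂ v (ρ v) = ((‖opSqrt ρ v‖ ^ 2 : ℝ) : ℂ) := by
  rw [← opSqrt_apply_apply hρ, ← inner_opSqrt_left, inner_self_eq_norm_sq_to_K]
  norm_cast

theorem IsDensityMatrix.hasSum_norm_sq_opSqrt {ρ : E →L[ℂ] E} (hρ : IsDensityMatrix ρ) :
    HasSum (fun i => ‖opSqrt ρ (onb E i)‖ ^ 2) 1 := by
  have h := hρ.trace_eq_one
  rw [positiveTrace] at h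
  simp_rw [inner_apply_eq_norm_sq_opSqrt hρ.isPositive, Complex.ofReal_re] at h
  have h1 : Summable fun i => ‖opSqrt ρ (onb E i)‖ ^ 2 := by
    have := ENNReal.summable_toReal (f := fun i => ENNReal.ofReal (‖opSqrt ρ (onb E i)‖ ^ 2))
      (by rw [h]; simp)
    simpa [ENNReal.toReal_ofReal, sq_nonneg] using this
  rw [← ENNReal.ofReal_tsum_of_nonneg (fun _ => sq_nonneg _) h1, ENNReal.ofReal_eq_one] at h
  rw [← h]
  exact h1.hasSum

/-- The trace of `ρ P` for a density matrix `ρ` and an orthogonal projection `P`. -/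
theorem IsDensityMatrix.opTrace_mul {ρ : E →L[ℂ] E} (hρ : IsDensityMatrix ρ) {P : E →L[ℂ] E}
    (hP : IsStarProjection P) :
    opTrace (ρ * P) = ((∑' i, ‖P (opSqrt ρ (onb E i))‖ ^ 2 : ℝ) : ℂ) := by
  set S := opSqrt ρ
  set b := onb E
  have hPle : ∀ v, ‖P v‖ ^ 2 ≤ ‖v‖ ^ 2 := by
    intro v
    have h1 : (‖P v‖ ^ 2 : ℝ) ≤ ‖v‖ * ‖P v‖ := by
      have := norm_inner_le_norm (𝕜 := ℂ) v (P v)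
      rwa [norm_sq_starProjection hP, Complex.norm_real, Real.norm_eq_abs,
        abs_of_nonneg (sq_nonneg _)] at this
    have h2 : ‖P v‖ ≤ ‖v‖ := by
      by_contra! h
      nlinarith [norm_nonneg v]
    gcongr
  have hS (v w : E) : inner ℂ (S v) w = inner ℂ v (S w) := inner_opSqrt_left ρ v w
  have hSb := hρ.hasSum_norm_sq_opSqrt.summable
  have hPS : Summable fun i => ‖P (S (b i))‖ ^ 2 :=
    Summable.of_nonneg_of_le (fun _ => sq_nonneg _) (fun i => hPle _) hSb
  -- the double series of matrix elements
  set F : onbIndex E × onbIndex E → ℂ := fun z =>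
    inner ℂ (S (b z.1)) (b z.2) * inner ℂ (b z.2) (S (P (b z.1)))
  have hsym : ∀ i j, ‖inner ℂ (b j) (S (P (b i)))‖ = ‖inner ℂ (b i) (P (S (b j)))‖ := by
    intro i j
    rw [← inner_opSqrt_left, ← inner_starProjection_left hP, norm_inner_symm]
  have hs1 : Summable fun z : onbIndex E × onbIndex E => ‖inner ℂ (S (b z.1)) (b z.2)‖ ^ 2 := by
    rw [summable_prod_of_nonneg fun _ => sq_nonneg _]
    have e (i) : HasSum (fun j => ‖inner ℂ (S (b i)) (b j)‖ ^ 2) (‖S (b i)‖ ^ 2) := by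
      simpa only [norm_inner_symm] using hasSum_norm_sq_inner b (S (b i))
    exact ⟨fun i => (e i).summable, by simpa only [(e _).tsum_eq] using hSb⟩
  have hs2 : Summable fun z : onbIndex E × onbIndex E =>
      ‖inner ℂ (b z.2) (S (P (b z.1)))‖ ^ 2 := by
    suffices h : Summable fun z : onbIndex E × onbIndex E =>
        ‖inner ℂ (b z.1) (S (P (b z.2)))‖ ^ 2 from (Equiv.prodComm _ _).summable_iff.2 h
    rw [summable_prod_of_nonneg fun _ => sq_nonneg _]
    have e (j) : HasSum (fun i => ‖inner ℂ (b j) (S (P (b i)))‖ ^ 2) (‖P (S (b j))‖ ^ 2) := by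
      simpa only [hsym] using hasSum_norm_sq_inner b (P (S (b j)))
    exact ⟨fun j => (e j).summable, by simpa only [(e _).tsum_eq] using hPS⟩
  -- Both √ρ and √ρ P are Hilbert–Schmidt, so their matrix elements are square summable and the
  -- products are absolutely summable. This licenses exchanging the two sums, which is cyclicity of
  -- the trace.
  have hF : Summable F := by
    refine Summable.of_norm_bounded (hs1.add hs2) fun z => ?_
    rw [norm_mul]
    nlinarith [sq_nonneg (‖inner ℂ (S (b z.1)) (b z.2)‖ - ‖inner ℂ (b z.2) (S (P (b z.1)))‖),
      sq_nonneg ‖inner ℂ (S (b z.1)) (b z.2)‖, sq_nonneg ‖inner ℂ (b z.2) (S (P (b z.1)))‖]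
  have e1 (i) : inner ℂ (b i) ((ρ * P) (b i)) = ∑' j, F (i, j) := by
    rw [(b.hasSum_inner_mul_inner (S (b i)) (S (P (b i)))).tsum_eq, inner_opSqrt_left,
      opSqrt_apply_apply hρ.isPositive]
    rfl
  have e2 (j) : ∑' i, F (i, j) = ((‖P (S (b j))‖ ^ 2 : ℝ) : ℂ) := by
    rw [← norm_sq_starProjection hP, ← inner_starProjection_left hP,
      ← (b.hasSum_inner_mul_inner (P (S (b j))) (S (b j))).tsum_eq]
    congr 1; funext i
    change inner ℂ (S (b i)) (b j) * inner ℂ (b j) (S (P (b i))) = _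
    rw [hS, ← hS (b j), ← inner_starProjection_left hP, mul_comm]
  change ∑' i, inner ℂ (b i) ((ρ * P) (b i)) = _
  simp_rw [e1]
  rw [← Summable.tsum_comm (f := fun i j => F (i, j)) hF]
  simp_rw [e2]
  rw [Complex.ofReal_tsum]

/-- The distribution function of an observable with a Borel functional calculus is that of a
probability measure, whose characteristic function is given by the functional calculus. -/
theorem IsBorelCalculus.exists_measure_opCDF {A : E →ₗ.[ℂ] E} {Φ : (ℝ → ℂ) → E →L[ℂ] E}
    (hΦ : IsBorelCalculus A Φ) {ρ : E →L[ℂ] E} (hρ : IsDensityMatrix ρ) :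
    ∃ μ : Measure ℝ, IsFiniteMeasure μ ∧ (opCDF ρ A = fun x => μ.real (Set.Iic x)) ∧
      ∀ u : ℝ, HasSum (fun i => inner ℂ (opSqrt ρ (onb E i))
        (Φ (fun t => Complex.exp (u * t * Complex.I)) (opSqrt ρ (onb E i)))) (charFun μ u) := by
  -- The required measure is the sum of the spectral measures of the vectors √ρ eᵢ.
  choose m hfin hm _ _ using fun i => hΦ.measure (opSqrt ρ (onb E i))
  have hmeas (M : Set ℝ) (hM : MeasurableSet M) (i) := hΦ.measure_eq (hm i) hM
  have hfinite : IsFiniteMeasure (Measure.sum m) := by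
    refine ⟨?_⟩
    rw [Measure.sum_apply _ MeasurableSet.univ]
    simp_rw [hmeas _ MeasurableSet.univ, Set.indicator_univ, hΦ.map_one, one_apply_eq_self]
    rw [← ENNReal.ofReal_tsum_of_nonneg (fun _ => sq_nonneg _) hρ.hasSum_norm_sq_opSqrt.summable]
    exact ENNReal.ofReal_lt_top
  refine ⟨Measure.sum m, hfinite, ?_, fun u => ?_⟩
  · funext x
    rw [opCDF, hΦ.spectralProjection_Iic,
      hρ.opTrace_mul (hΦ.isStarProjection_indicator measurableSet_Iic), Complex.ofReal_re,
      Measure.real, Measure.sum_apply _ measurableSet_Iic]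
    simp_rw [hmeas _ measurableSet_Iic]
    rw [ENNReal.tsum_toReal_eq fun _ => ENNReal.ofReal_ne_top]
    simp_rw [ENNReal.toReal_ofReal (sq_nonneg _)]
  · simp_rw [hm _ _ (.exp u), charFun_apply_real]
    exact hasSum_integral_measure ((IsBoundedBorel.exp u).integrable _)

end Trace

end Hilbert

/-! ### Unitarity of the vector-valued Fourier transform. -/

section Fourier

variable {K : Type*} [NormedAddCommGroup K] [InnerProductSpace ℂ K] [CompleteSpace K]

/-- Reduces to the scalar function ⟪v, f(p)⟫, all of whose Fourier coefficients vanish. -/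
theorem ae_inner_eq_zero_of_orthogonal_planeWave {f : MomentumSpace K} {v : K}
    (h : ∀ k : ℤ, inner ℂ (planeWave k v) f = 0) :
    (fun p => inner ℂ v (f p)) =ᵐ[AddCircle.haarAddCircle] 0 := by
  have hm : MemLp (fun p => inner ℂ v (f p)) 2 (AddCircle.haarAddCircle : Measure Torus) :=
    (Lp.memLp f).const_inner v
  have hz : hm.toLp _ = 0 := by
    rw [← (fourierBasis (T := 2 * Real.pi)).repr.map_eq_zero_iff]
    ext k
    rw [HilbertBasis.repr_apply_apply, coe_fourierBasis, L2.inner_def, lp.coeFn_zero, Pi.zero_apply,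
      ← h k, L2.inner_def]
    refine integral_congr_ae ?_
    filter_upwards [hm.coeFn_toLp, coeFn_fourierLp (T := 2 * Real.pi) 2 k,
      (memLp_planeWave k v).coeFn_toLp] with p h1 h2 h3
    have h3' : (planeWave k v : MomentumSpace K) p = fourier k p • v := h3
    rw [h1, h2, h3', inner_smul_left, RCLike.inner_apply, mul_comm]
  have h2 := hm.coeFn_toLp
  rw [hz] at h2
  exact h2.symm.trans (Lp.coeFn_zero _ _ _)

/-- If f is orthogonal to all plane waves, each functional kills f(p) off a null set that depends on
the functional. K need not be separable, but f has essentially separable range, so the exceptional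
sets can be combined. -/
theorem latticeFourier_surjective : Function.Surjective (latticeFourier (K := K)) := by
  have h : (latticeFourier (K := K)).range = ⊤ := by
    rw [latticeFourier, OrthogonalFamily.range_linearIsometry,
      Submodule.topologicalClosure_eq_top_iff, Submodule.eq_bot_iff]
    intro f hf
    have h0 : ∀ (k : ℤ) (v : K), inner ℂ (planeWave k v) f = 0 := fun k v =>
      hf _ (Submodule.mem_iSup_of_mem k ⟨v, rfl⟩)
    obtain ⟨t, ht, hft⟩ := (Lp.aestronglyMeasurable f).isSeparable_ae_range
    refine (Lp.eq_zero_iff_ae_eq_zero).2 (ae_eq_zero_of_forall_dual_of_isSeparable ℂ ht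
      (fun c => ?_) hft)
    filter_upwards [ae_inner_eq_zero_of_orthogonal_planeWave
      (v := (InnerProductSpace.toDual ℂ K).symm c) fun k => h0 k _] with p hp
    rwa [InnerProductSpace.toDual_symm_apply] at hp
  exact LinearMap.range_eq_top.1 h

/-- The Fourier transform as a unitary operator. -/
def fourierEquiv : LatticeSpace K ≃ₗᵢ[ℂ] MomentumSpace K :=
  LinearIsometryEquiv.ofSurjective latticeFourier latticeFourier_surjective

theorem latticeFourier_fourierEquiv_symm (f : MomentumSpace K) :
    latticeFourier (fourierEquiv.symm f) = f := fourierEquiv.apply_symm_apply f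

end Fourier

/-! ### Diagonal operators on the lattice and the first absolute moment. -/

section Diagonal

variable {K : Type*} [NormedAddCommGroup K] [InnerProductSpace ℂ K]

theorem memℓp_two_iff {f : ℤ → K} : Memℓp f 2 ↔ Summable fun k => ‖f k‖ ^ 2 := by
  rw [memℓp_gen_iff (by norm_num)]
  norm_num

theorem lattice_hasSum_norm_sq (ψ : LatticeSpace K) :
    HasSum (fun k => ‖ψ k‖ ^ 2) (‖ψ‖ ^ 2) := by
  simpa using lp.hasSum_norm (by norm_num) ψ

theorem lattice_norm_sq_le {ψ φ : LatticeSpace K} {C : ℝ} (hC : 0 ≤ C)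
    (h : ∀ k, ‖ψ k‖ ≤ C * ‖φ k‖) : ‖ψ‖ ≤ C * ‖φ‖ := by
  have h1 := hasSum_le (fun k => (pow_le_pow_left₀ (norm_nonneg _) (h k) 2).trans_eq
    (mul_pow _ _ _)) (lattice_hasSum_norm_sq ψ) ((lattice_hasSum_norm_sq φ).mul_left (C ^ 2))
  rw [← mul_pow] at h1
  exact (pow_le_pow_iff_left₀ (norm_nonneg _) (by positivity) two_ne_zero).1 h1

theorem memℓp_diag {h : ℤ → ℂ} (H : ∃ C, ∀ k, ‖h k‖ ≤ C) (ψ : LatticeSpace K) :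
    Memℓp (fun k => h k • ψ k) 2 := by
  obtain ⟨C, hC⟩ := H
  rw [memℓp_two_iff]
  refine Summable.of_nonneg_of_le (fun _ => sq_nonneg _) (fun k => ?_)
    ((lattice_hasSum_norm_sq ψ).summable.mul_left (C ^ 2))
  rw [norm_smul, mul_pow]
  have := hC k
  gcongr

open Classical in
/-- The diagonal operator `(diagOp h ψ)_k = h_k ψ_k` for a bounded sequence `h`. -/
def diagOp (h : ℤ → ℂ) : LatticeSpace K →L[ℂ] LatticeSpace K :=
  if H : ∃ C, ∀ k, ‖h k‖ ≤ C then
    LinearMap.mkContinuousOfExistsBound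
      { toFun := fun ψ => ⟨fun k => h k • ψ k, memℓp_diag H ψ⟩
        map_add' := fun ψ φ => by
          ext k
          exact smul_add (h k) (ψ k) (φ k)
        map_smul' := fun c ψ => by
          ext k
          exact smul_comm (h k) c (ψ k) }
      (by
        obtain ⟨C, hC⟩ := H
        exact ⟨C, fun ψ => lattice_norm_sq_le ((norm_nonneg _).trans (hC 0)) fun k => by
          change ‖h k • ψ k‖ ≤ _
          rw [norm_smul]
          exact mul_le_mul_of_nonneg_right (hC k) (norm_nonneg _)⟩)
  else 0

theorem diagOp_apply {h : ℤ → ℂ} (H : ∃ C, ∀ k, ‖h k‖ ≤ C) (ψ : LatticeSpace K) (k : ℤ) :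
    diagOp h ψ k = h k • ψ k := by
  rw [diagOp, dif_pos H]
  rfl

theorem diagOp_mul {g h : ℤ → ℂ} (G : ∃ C, ∀ k, ‖g k‖ ≤ C) (H : ∃ C, ∀ k, ‖h k‖ ≤ C) :
    diagOp (K := K) (fun k => g k * h k) = diagOp g * diagOp h := by
  have GH : ∃ C, ∀ k, ‖g k * h k‖ ≤ C := by
    obtain ⟨C, hC⟩ := G
    obtain ⟨D, hD⟩ := H
    refine ⟨C * D, fun k => ?_⟩
    rw [norm_mul]
    exact mul_le_mul (hC k) (hD k) (norm_nonneg _) ((norm_nonneg _).trans (hC k))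
  ext ψ k
  rw [mul_apply_eq_comp, diagOp_apply GH, diagOp_apply G, diagOp_apply H, mul_smul]

theorem diagOp_one : diagOp (K := K) (fun _ => 1) = 1 := by
  ext ψ k
  rw [diagOp_apply ⟨1, fun _ => by simp⟩, one_smul, one_apply_eq_self]

theorem star_diagOp [CompleteSpace K] {h : ℤ → ℂ} (H : ∃ C, ∀ k, ‖h k‖ ≤ C) :
    diagOp (K := K) (fun k => star (h k)) = star (diagOp (K := K) h) := by
  have H' : ∃ C, ∀ k, ‖star (h k)‖ ≤ C := by simpa using H
  rw [ContinuousLinearMap.star_eq_adjoint, ContinuousLinearMap.eq_adjoint_iff]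
  intro ψ φ
  rw [lp.inner_eq_tsum, lp.inner_eq_tsum]
  congr 1; funext k
  rw [diagOp_apply H', diagOp_apply H, inner_smul_left, inner_smul_right]
  simp

/-- `∑ₓ |x| ‖ψₓ‖²`. -/
def absMoment (ψ : LatticeSpace K) : ENNReal := ∑' x : ℤ, ENNReal.ofReal (|(x : ℝ)| * ‖ψ x‖ ^ 2)

/-- The momentum translation `e^{isX}`. -/
def phaseOp (s : ℝ) : LatticeSpace K →L[ℂ] LatticeSpace K :=
  diagOp fun k => Complex.exp (((s * k : ℝ) : ℂ) * Complex.I)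

theorem phaseOp_bounded (s : ℝ) :
    ∃ C, ∀ k : ℤ, ‖Complex.exp (((s * k : ℝ) : ℂ) * Complex.I)‖ ≤ C :=
  ⟨1, fun k => by rw [Complex.norm_exp_ofReal_mul_I]⟩

theorem phaseOp_apply (s : ℝ) (ψ : LatticeSpace K) (k : ℤ) :
    phaseOp s ψ k = Complex.exp (((s * k : ℝ) : ℂ) * Complex.I) • ψ k :=
  diagOp_apply (phaseOp_bounded s) ψ k

/-- Interpolating |e^{isx} - 1| ≤ |sx| with |e^{isx} - 1| ≤ 2 gives |e^{isx} - 1|² ≤ 2|s||x|, so a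
first moment suffices, at the price of a rate √|s|. -/
theorem norm_phaseOp_sub_sq_le (s : ℝ) {ψ : LatticeSpace K} (hψ : absMoment ψ ≠ ⊤) :
    ‖phaseOp s ψ - ψ‖ ^ 2 ≤ 2 * |s| * (absMoment ψ).toReal := by
  have hs : HasSum (fun x : ℤ => |(x : ℝ)| * ‖ψ x‖ ^ 2) (absMoment ψ).toReal := by
    have h1 := ENNReal.hasSum_toReal hψ
    simp_rw [ENNReal.toReal_ofReal (mul_nonneg (abs_nonneg _) (sq_nonneg _))] at h1
    rw [absMoment, ENNReal.tsum_toReal_eq fun _ => ENNReal.ofReal_ne_top]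
    simp_rw [ENNReal.toReal_ofReal (mul_nonneg (abs_nonneg _) (sq_nonneg _))]
    exact h1
  refine hasSum_le (fun k => ?_) (lattice_hasSum_norm_sq (phaseOp s ψ - ψ)) (hs.mul_left (2 * |s|))
  rw [lp.coeFn_sub, Pi.sub_apply, phaseOp_apply]
  set z := Complex.exp (((s * k : ℝ) : ℂ) * Complex.I) with hz
  have e : z • ψ k - ψ k = (z - 1) • ψ k := by rw [sub_smul, one_smul]
  rw [e, norm_smul, mul_pow, ← mul_assoc]
  gcongr
  have h1 : ‖z - 1‖ ≤ |s| * |(k : ℝ)| := by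
    have := Real.norm_exp_I_mul_ofReal_sub_one_le (x := s * k)
    rw [mul_comm Complex.I] at this
    rwa [Real.norm_eq_abs, abs_mul] at this
  have h2 : ‖z - 1‖ ≤ 2 := by
    refine (norm_sub_le _ _).trans ?_
    rw [hz, Complex.norm_exp_ofReal_mul_I, norm_one]
    norm_num
  nlinarith [norm_nonneg (z - 1), mul_nonneg (abs_nonneg s) (abs_nonneg (k : ℝ))]

/-- Basis independence of the trace: Parseval in K and in the lattice space, with Tonelli, for the
matrix elements of √ρ between δₓ ⊗ eₐ and the chosen basis. -/
theorem tsum_absMoment_eq [CompleteSpace K] {ρ : LatticeSpace K →L[ℂ] LatticeSpace K}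
    (hρ : ρ.IsPositive) :
    ∑' i, absMoment (opSqrt ρ (onb (LatticeSpace K) i)) = traceAbsPosition ρ := by
  rw [traceAbsPosition]
  simp_rw [absMoment, inner_apply_eq_norm_sq_opSqrt hρ, Complex.ofReal_re]
  rw [ENNReal.tsum_comm]
  congr 1; funext x
  have e (a) : ENNReal.ofReal (|(x : ℝ)| * ‖opSqrt ρ (lp.single 2 x (onb K a))‖ ^ 2) =
      ∑' i, ENNReal.ofReal |(x : ℝ)| * ENNReal.ofReal
        (‖inner ℂ (onb K a) (opSqrt ρ (onb (LatticeSpace K) i) x)‖ ^ 2) := by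
    rw [ENNReal.ofReal_mul (abs_nonneg _), ← tsum_norm_sq_inner_ofReal (onb (LatticeSpace K)),
      ENNReal.tsum_mul_left]
    congr 2; funext i
    rw [← inner_opSqrt_left, norm_inner_symm, lp.inner_single_left]
  simp_rw [e]
  rw [ENNReal.tsum_comm]
  congr 1; funext i
  rw [ENNReal.tsum_mul_left, tsum_norm_sq_inner_ofReal, ENNReal.ofReal_mul (abs_nonneg _)]

end Diagonal

/-! ### The position operator generates translations in momentum. -/

section Translation

variable {K : Type*} [NormedAddCommGroup K] [InnerProductSpace ℂ K] [CompleteSpace K]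

/-- On δₖ ⊗ v this is e^{isk} e^{ikp} = e^{ik(p+s)}; both sides are continuous in ψ, so it extends
to sums. -/
theorem latticeFourier_phaseOp (s : ℝ) (ψ : LatticeSpace K) :
    ∀ᵐ p ∂(AddCircle.haarAddCircle : Measure Torus),
      latticeFourier (phaseOp s ψ) p = latticeFourier ψ (p + (s : Torus)) := by
  have hmp := measurePreserving_add_right (AddCircle.haarAddCircle : Measure Torus) (s : Torus)
  set τ := Lp.compMeasurePreservingₗᵢ (E := K) (p := 2) ℂ (fun p : Torus => p + s) hmp with hτ
  have key : latticeFourier (phaseOp s ψ) = τ (latticeFourier ψ) := by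
    have h1 := ((latticeFourier (K := K)).toContinuousLinearMap.comp (phaseOp s)).hasSum
      (lp.hasSum_single (p := 2) (by norm_num) ψ)
    have h2 := (τ.toContinuousLinearMap.comp (latticeFourier (K := K)).toContinuousLinearMap).hasSum
      (lp.hasSum_single (p := 2) (by norm_num) ψ)
    refine h1.unique ?_
    convert h2 using 1
    swap
    · rfl
    funext k
    have e : phaseOp s (lp.single 2 k (ψ k) : LatticeSpace K) =
        lp.single 2 k (Complex.exp (((s * k : ℝ) : ℂ) * Complex.I) • ψ k) := by
      ext j
      rw [phaseOp_apply]
      by_cases hj : j = k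
      · subst hj; simp
      · simp [hj]
    change latticeFourier (phaseOp s (lp.single 2 k (ψ k))) =
      τ (latticeFourier (lp.single 2 k (ψ k)))
    rw [e, latticeFourier, OrthogonalFamily.linearIsometry_apply_single,
      OrthogonalFamily.linearIsometry_apply_single, Lp.ext_iff]
    have h3 : (τ (planeWave k (ψ k)) : MomentumSpace K) =ᵐ[AddCircle.haarAddCircle]
        (planeWave k (ψ k) : MomentumSpace K) ∘ fun p : Torus => p + s :=
      Lp.coeFn_compMeasurePreserving _ hmp
    have h4 := (memLp_planeWave k (ψ k)).coeFn_toLp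
    filter_upwards [h3, (memLp_planeWave k
      (Complex.exp (((s * k : ℝ) : ℂ) * Complex.I) • ψ k)).coeFn_toLp,
      hmp.quasiMeasurePreserving.ae h4] with p h5 h6 h7
    have h6' : (planeWave k (Complex.exp (((s * k : ℝ) : ℂ) * Complex.I) • ψ k) :
      MomentumSpace K) p = fourier k p • Complex.exp (((s * k : ℝ) : ℂ) * Complex.I) • ψ k := h6
    have h7' : (planeWave k (ψ k) : MomentumSpace K) (p + s) = fourier k (p + (s : Torus)) • ψ k := h7
    rw [h5, h6', Function.comp_apply, h7', smul_smul]
    congr 1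
    have hadd : fourier k (p + (s : Torus)) = fourier k p * fourier k (s : Torus) := by
      simp only [fourier_apply, smul_add, AddCircle.toCircle_add, Circle.coe_mul]
    rw [hadd, fourier_coe_apply]
    congr 2
    push_cast
    field_simp
  rw [key]
  exact Lp.coeFn_compMeasurePreserving _ hmp

end Translation

/-! ### Functional calculus of Xₙ: multiplication by g(k/n), conjugated by W^n. -/

section PositionCalculus

variable {K : Type*} [NormedAddCommGroup K] [InnerProductSpace ℂ K]

theorem mem_rescaledPositionOp_domain (W : LatticeSpace K ≃ₗᵢ[ℂ] LatticeSpace K) (n : ℕ)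
    {ψ : LatticeSpace K} :
    ψ ∈ (rescaledPositionOp W n).domain ↔ (W ^ n) ψ ∈ (positionOp (K := K)).domain := by
  rw [rescaledPositionOp, Submodule.mem_comap]
  rfl

theorem rescaledPositionOp_apply (W : LatticeSpace K ≃ₗᵢ[ℂ] LatticeSpace K) (n : ℕ)
    {ψ : LatticeSpace K} (h : ψ ∈ (rescaledPositionOp W n).domain) :
    rescaledPositionOp W n ⟨ψ, h⟩ = (n : ℂ)⁻¹ • (W ^ n).symm
      (positionOp ⟨(W ^ n) ψ, (mem_rescaledPositionOp_domain W n).1 h⟩) := by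
  change ((n : ℂ)⁻¹ • ((W ^ n)⁻¹.toLinearEquiv.toLinearMap ∘ₗ positionOp.toFun ∘ₗ
    (W ^ n).toLinearEquiv.toLinearMap.restrict fun _ h => h)) ⟨ψ, h⟩ = _
  rw [LinearMap.smul_apply]
  rfl

theorem mem_positionOp_domain {φ : LatticeSpace K} :
    φ ∈ (positionOp (K := K)).domain ↔ Memℓp (fun k : ℤ => (k : ℂ) • φ k) 2 := Iff.rfl

theorem positionOp_apply {φ : LatticeSpace K} (h : φ ∈ (positionOp (K := K)).domain) (k : ℤ) :
    positionOp ⟨φ, h⟩ k = (k : ℂ) • φ k := rfl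

/-- The Borel functional calculus of `W^{-n} X W^n / n`. -/
def positionCalculus (W : LatticeSpace K ≃ₗᵢ[ℂ] LatticeSpace K) (n : ℕ) (g : ℝ → ℂ) :
    LatticeSpace K →L[ℂ] LatticeSpace K :=
  ((W ^ n).symm.toContinuousLinearEquiv : LatticeSpace K →L[ℂ] LatticeSpace K) ∘L
    (diagOp fun k : ℤ => g (k / n)) ∘L
    ((W ^ n).toContinuousLinearEquiv : LatticeSpace K →L[ℂ] LatticeSpace K)

theorem positionCalculus_apply (W : LatticeSpace K ≃ₗᵢ[ℂ] LatticeSpace K) (n : ℕ) (g : ℝ → ℂ)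
    (ψ : LatticeSpace K) : positionCalculus W n g ψ =
      (W ^ n).symm (diagOp (fun k : ℤ => g (k / n)) ((W ^ n) ψ)) := rfl

theorem IsBoundedBorel.comp_div {g : ℝ → ℂ} (hg : IsBoundedBorel g) (n : ℕ) :
    ∃ C, ∀ k : ℤ, ‖g (k / n)‖ ≤ C :=
  let ⟨C, hC⟩ := hg.bounded
  ⟨C, fun _ => hC _⟩

/-- The spectral measure of `X / n` in the state `φ`. -/
def positionMeasure (n : ℕ) (φ : LatticeSpace K) : Measure ℝ :=
  Measure.sum fun k : ℤ => ENNReal.ofReal (‖φ k‖ ^ 2) • Measure.dirac ((k : ℝ) / n)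

theorem lintegral_positionMeasure (n : ℕ) (φ : LatticeSpace K) {f : ℝ → ENNReal}
    (hf : Measurable f) : ∫⁻ t, f t ∂(positionMeasure n φ) =
      ∑' k : ℤ, ENNReal.ofReal (‖φ k‖ ^ 2) * f (k / n) := by
  rw [positionMeasure, lintegral_sum_measure]
  congr 1; funext k
  rw [lintegral_smul_measure, lintegral_dirac' _ hf, smul_eq_mul]

instance (n : ℕ) (φ : LatticeSpace K) : IsFiniteMeasure (positionMeasure n φ) := by
  refine ⟨?_⟩
  rw [← lintegral_one, lintegral_positionMeasure n φ measurable_const]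
  simp_rw [mul_one]
  rw [← ENNReal.ofReal_tsum_of_nonneg (fun _ => sq_nonneg _) (lattice_hasSum_norm_sq φ).summable]
  exact ENNReal.ofReal_lt_top

theorem hasSum_integral_positionMeasure (n : ℕ) (φ : LatticeSpace K) {F : Type*}
    [NormedAddCommGroup F] [NormedSpace ℝ F] [CompleteSpace F] {f : ℝ → F}
    (hf : Integrable f (positionMeasure n φ)) :
    HasSum (fun k : ℤ => (‖φ k‖ ^ 2) • f (k / n)) (∫ t, f t ∂(positionMeasure n φ)) := by
  have h := hasSum_integral_measure hf
  refine h.congr_fun fun k => ?_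
  rw [integral_smul_measure, integral_dirac, ENNReal.toReal_ofReal (sq_nonneg _)]

theorem isBorelCalculus_position [CompleteSpace K] (W : LatticeSpace K ≃ₗᵢ[ℂ] LatticeSpace K)
    {n : ℕ} (hn : 1 ≤ n) :
    IsBorelCalculus (rescaledPositionOp W n) (positionCalculus W n) where
  map_one := by
    ext1 ψ
    rw [positionCalculus_apply, diagOp_one, one_apply_eq_self, one_apply_eq_self,
      LinearIsometryEquiv.symm_apply_apply]
  map_mul g h hg hh := by
    ext1 ψ
    rw [mul_apply_eq_comp, positionCalculus_apply, positionCalculus_apply, positionCalculus_apply,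
      LinearIsometryEquiv.apply_symm_apply, diagOp_mul (hg.comp_div n) (hh.comp_div n)]
    rfl
  map_star g hg := by
    rw [ContinuousLinearMap.star_eq_adjoint, ContinuousLinearMap.eq_adjoint_iff]
    intro ψ φ
    rw [positionCalculus_apply, positionCalculus_apply, star_diagOp (hg.comp_div n),
      ContinuousLinearMap.star_eq_adjoint, ← (W ^ n).inner_map_map,
      LinearIsometryEquiv.apply_symm_apply, ContinuousLinearMap.adjoint_inner_left,
      ← (W ^ n).inner_map_map ψ, LinearIsometryEquiv.apply_symm_apply]
  measure ψ := by
    set φ := (W ^ n) ψ with hφ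
    have hn0 : (n : ℝ) ≠ 0 := by positivity
    have hnC : (n : ℂ) ≠ 0 := by exact_mod_cast hn0
    have hdom : ψ ∈ (rescaledPositionOp W n).domain ↔
        ∫⁻ t, ENNReal.ofReal (t ^ 2) ∂(positionMeasure n φ) < ⊤ := by
      rw [mem_rescaledPositionOp_domain, mem_positionOp_domain,
        lintegral_positionMeasure n φ (by fun_prop), memℓp_two_iff]
      have e (k : ℤ) : ENNReal.ofReal (‖φ k‖ ^ 2) * ENNReal.ofReal ((k / n : ℝ) ^ 2) =
          ENNReal.ofReal (((n : ℝ) ^ 2)⁻¹ * ‖(k : ℂ) • φ k‖ ^ 2) := by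
        rw [← ENNReal.ofReal_mul (sq_nonneg _), norm_smul, Complex.norm_intCast, mul_pow, sq_abs,
          div_pow]
        congr 1
        field_simp
      simp_rw [e]
      have hnn (k : ℤ) : 0 ≤ ((n : ℝ) ^ 2)⁻¹ * ‖(k : ℂ) • φ k‖ ^ 2 := by positivity
      rw [← summable_mul_left_iff (a := ((n : ℝ) ^ 2)⁻¹) (by positivity)]
      constructor
      · intro h
        rw [← ENNReal.ofReal_tsum_of_nonneg hnn h]
        exact ENNReal.ofReal_lt_top
      · intro h
        have := ENNReal.summable_toReal h.ne
        simpa only [ENNReal.toReal_ofReal (hnn _)] using this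
    refine ⟨positionMeasure n φ, inferInstance, fun g hg => ?_, hdom, fun h => ?_⟩
    · rw [positionCalculus_apply, ← (W ^ n).inner_map_map, LinearIsometryEquiv.apply_symm_apply]
      refine (lp.hasSum_inner _ _).unique
        ((hasSum_integral_positionMeasure n φ (hg.integrable _)).congr_fun fun k => ?_)
      rw [diagOp_apply (hg.comp_div n), inner_smul_right, inner_self_eq_norm_sq_to_K,
        Complex.real_smul, mul_comm]
      norm_cast
    · have hd := hdom.1 h
      rw [rescaledPositionOp_apply, inner_smul_right, ← (W ^ n).inner_map_map,
        LinearIsometryEquiv.apply_symm_apply]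
      refine ((lp.hasSum_inner φ _).mul_left (n : ℂ)⁻¹).unique
        ((Complex.hasSum_ofReal.2 (hasSum_integral_positionMeasure n φ
          (IsSpectralMeasure.integrable_id hd))).congr_fun fun k => ?_)
      rw [positionOp_apply, inner_smul_right, inner_self_eq_norm_sq_to_K]
      simp
      field_simp
  apply_sub c g hg hcg ψ := by
    have hn0 : (n : ℝ) ≠ 0 := by positivity
    have hnC : (n : ℂ) ≠ 0 := by exact_mod_cast hn0
    set φ := (W ^ n) ψ with hφ
    have hWΦ (g : ℝ → ℂ) :
        (W ^ n) (positionCalculus W n g ψ) = diagOp (fun k : ℤ => g (k / n)) φ := by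
      rw [positionCalculus_apply, LinearIsometryEquiv.apply_symm_apply]
    have e (k : ℤ) : (k : ℂ) • diagOp (fun k : ℤ => g (k / n)) φ k = (n : ℂ) •
        (diagOp (fun k : ℤ => (((k / n : ℝ) : ℂ) - c) * g (k / n)) φ +
          (c : ℂ) • diagOp (fun k : ℤ => g (k / n)) φ : LatticeSpace K) k := by
      rw [lp.coeFn_add, Pi.add_apply, lp.coeFn_smul, Pi.smul_apply, diagOp_apply (hg.comp_div n),
        diagOp_apply (hcg.comp_div n), smul_smul, smul_smul, ← add_smul, smul_smul]
      congr 1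
      push_cast
      field_simp
      ring
    have hd : diagOp (fun k : ℤ => g (k / n)) φ ∈ (positionOp (K := K)).domain := by
      rw [mem_positionOp_domain]
      simp_rw [e]
      exact (lp.memℓp _).const_smul _
    have hdom : positionCalculus W n g ψ ∈ (rescaledPositionOp W n).domain := by
      rwa [mem_rescaledPositionOp_domain, hWΦ]
    refine ⟨hdom, ?_⟩
    apply (W ^ n).injective
    rw [rescaledPositionOp_apply, map_sub, map_smul, map_smul,
      LinearIsometryEquiv.apply_symm_apply]
    simp only [hWΦ g]
    rw [hWΦ fun t => ((t : ℂ) - c) * g t, sub_eq_iff_eq_add, inv_smul_eq_iff₀ hnC]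
    ext k
    rw [positionOp_apply, e]
    rfl

end PositionCalculus

/-! ### Orthogonal resolutions of the identity in a single fibre. -/

section Resolution

variable {K : Type*} [NormedAddCommGroup K] [InnerProductSpace ℂ K] [CompleteSpace K] {I : Type*}

/-- A resolution of the identity into mutually orthogonal projections. -/
structure IsResolution (π : I → K →L[ℂ] K) : Prop where
  isStarProjection : ∀ k, IsStarProjection (π k)
  orthogonal : ∀ j k, j ≠ k → π j * π k = 0
  hasSum : ∀ v, HasSum (fun k => π k v) v

namespace IsResolution

variable {π : I → K →L[ℂ] K}

theorem apply_self (hπ : IsResolution π) (k : I) (v : K) : π k (π k v) = π k v := by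
  conv_rhs => rw [← (hπ.isStarProjection k).isIdempotentElem.eq]
  rfl

theorem apply_of_ne (hπ : IsResolution π) {j k : I} (h : j ≠ k) (v : K) : π j (π k v) = 0 := by
  rw [← mul_apply_eq_comp, hπ.orthogonal j k h]; rfl

/-- Coefficients are read off by a projection. This makes composition of functions of the bands
multiplicative. -/
theorem apply_of_hasSum (hπ : IsResolution π) {c : I → ℂ} {v u : K}
    (h : HasSum (fun k => c k • π k v) u) (j : I) : π j u = c j • π j v := by
  refine ((π j).hasSum h).unique ?_
  have e : (c j • π j v) = π j (c j • π j v) := by rw [map_smul, hπ.apply_self]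
  rw [e]
  refine hasSum_single j fun k hk => ?_
  rw [map_smul, hπ.apply_of_ne hk.symm, smul_zero]

theorem hasSum_inner (hπ : IsResolution π) {c : I → ℂ} {v w u : K}
    (h : HasSum (fun k => c k • π k v) u) :
    HasSum (fun k => c k * inner ℂ (π k w) (π k v)) (inner ℂ w u) := by
  refine ((innerSL ℂ w).hasSum h).congr_fun fun k => ?_
  rw [innerSL_apply_apply, inner_smul_right, inner_starProjection_left (hπ.isStarProjection k),
    hπ.apply_self]

theorem hasSum_norm_sq (hπ : IsResolution π) {c : I → ℂ} {v u : K}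
    (h : HasSum (fun k => c k • π k v) u) :
    HasSum (fun k => ‖c k‖ ^ 2 * ‖π k v‖ ^ 2) (‖u‖ ^ 2) := by
  have h1 := hπ.hasSum_inner (w := u) h
  simp_rw [hπ.apply_of_hasSum h] at h1
  rw [inner_self_eq_norm_sq_to_K] at h1
  refine Complex.hasSum_ofReal.1 ?_
  rw [Complex.ofReal_pow]
  refine h1.congr_fun fun k => ?_
  rw [inner_smul_left, inner_self_eq_norm_sq_to_K, ← mul_assoc, Complex.mul_conj,
    Complex.normSq_eq_norm_sq]
  push_cast
  rfl

theorem hasSum_norm_sq_apply (hπ : IsResolution π) (v : K) :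
    HasSum (fun k => ‖π k v‖ ^ 2) (‖v‖ ^ 2) := by
  simpa using hπ.hasSum_norm_sq (c := fun _ => 1) (v := v) (u := v) (by simpa using hπ.hasSum v)

theorem summable_of_summable_norm_sq (hπ : IsResolution π) {c : I → ℂ} {v : K}
    (h : Summable fun k => ‖c k‖ ^ 2 * ‖π k v‖ ^ 2) : Summable fun k => c k • π k v := by
  have hV : OrthogonalFamily ℂ (fun k => (π k).range) fun k => (π k).range.subtypeₗᵢ := by
    rintro j k hjk ⟨_, v, rfl⟩ ⟨_, w, rfl⟩
    change inner ℂ (π j v) (π k w) = 0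
    rw [inner_starProjection_left (hπ.isStarProjection j), hπ.apply_of_ne hjk, inner_zero_right]
  have := (hV.summable_iff_norm_sq_summable fun k => c k • (⟨π k v, v, rfl⟩ : (π k).range)).2 (by
    refine h.congr fun k => ?_
    rw [norm_smul, mul_pow]
    rfl)
  exact this

theorem tsum_enorm_sq (hπ : IsResolution π) {c : I → ℂ} {v u : K}
    (h : HasSum (fun k => c k • π k v) u) :
    ∑' k, ‖c k‖ₑ ^ 2 * ‖π k v‖ₑ ^ 2 = ‖u‖ₑ ^ 2 := by
  have h1 := hπ.hasSum_norm_sq h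
  have e (k : I) : ‖c k‖ₑ ^ 2 * ‖π k v‖ₑ ^ 2 = ENNReal.ofReal (‖c k‖ ^ 2 * ‖π k v‖ ^ 2) := by
    rw [ENNReal.ofReal_mul (sq_nonneg _), ENNReal.ofReal_pow (norm_nonneg _),
      ENNReal.ofReal_pow (norm_nonneg _), ofReal_norm, ofReal_norm]
  simp_rw [e]
  rw [← ENNReal.ofReal_tsum_of_nonneg (fun _ => by positivity) h1.summable, h1.tsum_eq,
    ENNReal.ofReal_pow (norm_nonneg _), ofReal_norm]

theorem exists_hasSum (hπ : IsResolution π) {c : I → ℂ} {v : K}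
    (h : ∑' k, ‖c k‖ₑ ^ 2 * ‖π k v‖ₑ ^ 2 ≠ ⊤) : ∃ u, HasSum (fun k => c k • π k v) u := by
  have h1 := ENNReal.summable_toReal h
  simp only [ENNReal.toReal_mul, ENNReal.toReal_pow, toReal_enorm] at h1
  exact (hπ.summable_of_summable_norm_sq h1)

theorem norm_le_of_hasSum (hπ : IsResolution π) {c : I → ℂ} {v u : K} {C : ℝ} (hC0 : 0 ≤ C)
    (hC : ∀ k, ‖c k‖ ≤ C) (h : HasSum (fun k => c k • π k v) u) : ‖u‖ ≤ C * ‖v‖ := by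
  have h1 := hasSum_le (fun k => mul_le_mul_of_nonneg_right
    (pow_le_pow_left₀ (norm_nonneg _) (hC k) 2) (sq_nonneg ‖π k v‖)) (hπ.hasSum_norm_sq h)
    ((hπ.hasSum_norm_sq_apply v).mul_left (C ^ 2))
  rw [← mul_pow] at h1
  exact (pow_le_pow_iff_left₀ (norm_nonneg _) (by positivity) two_ne_zero).1 h1

/-- A family of phases defines a unitary, so the projections sum to the identity. -/
theorem of_unitary (hproj : ∀ k, IsStarProjection (π k)) (horth : ∀ j k, j ≠ k → π j * π k = 0)
    {θ : I → ℝ} {U : K →L[ℂ] K} (hU : ∀ v, ‖U v‖ = ‖v‖)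
    (h : ∀ v, HasSum (fun k => Complex.exp (Complex.I * θ k) • π k v) (U v)) :
    IsResolution π := by
  have hself (k : I) (v : K) : π k (π k v) = π k v := by
    conv_rhs => rw [← (hproj k).isIdempotentElem.eq]
    rfl
  have hne {j k : I} (hjk : j ≠ k) (v : K) : π j (π k v) = 0 := by
    rw [← mul_apply_eq_comp, horth j k hjk]; rfl
  -- Parseval for U v: the phases have modulus 1 and ‖U v‖ = ‖v‖.
  have key (v : K) : HasSum (fun k => ‖π k v‖ ^ 2) (‖v‖ ^ 2) := by
    have h1 := (innerSL ℂ (U v)).hasSum (h v)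
    have h2 (j : I) : π j (U v) = Complex.exp (Complex.I * θ j) • π j v := by
      refine ((π j).hasSum (h v)).unique ?_
      have e : (Complex.exp (Complex.I * θ j) • π j v) =
        π j (Complex.exp (Complex.I * θ j) • π j v) := by rw [map_smul, hself]
      rw [e]
      refine hasSum_single j fun k hk => ?_
      rw [map_smul, hne hk.symm, smul_zero]
    rw [innerSL_apply_apply, inner_self_eq_norm_sq_to_K, hU] at h1
    refine Complex.hasSum_ofReal.1 ?_
    rw [Complex.ofReal_pow]
    refine h1.congr_fun fun k => ?_
    rw [innerSL_apply_apply, inner_smul_right, ← hself k v,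
      ← inner_starProjection_left (hproj k), h2, hself, inner_smul_left, inner_self_eq_norm_sq_to_K,
      ← mul_assoc, Complex.mul_conj, Complex.normSq_eq_norm_sq, mul_comm Complex.I,
      Complex.norm_exp_ofReal_mul_I]
    simp
  refine ⟨hproj, horth, fun v => ?_⟩
  have hV : OrthogonalFamily ℂ (fun k => (π k).range) fun k => (π k).range.subtypeₗᵢ := by
    rintro j k hjk ⟨_, v, rfl⟩ ⟨_, w, rfl⟩
    change inner ℂ (π j v) (π k w) = 0
    rw [inner_starProjection_left (hproj j), hne hjk, inner_zero_right]
  have hs : Summable fun k => π k v :=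
    (hV.summable_iff_norm_sq_summable fun k => (⟨π k v, v, rfl⟩ : (π k).range)).2 (key v).summable
  obtain ⟨u, hu⟩ := hs
  have h3 (j : I) : π j u = π j v := by
    refine ((π j).hasSum hu).unique ?_
    rw [← hself j v]
    exact hasSum_single j fun k hk => hne hk.symm v
  -- Every projection kills v - u, so Parseval forces v = u, the sum of the components.
  have h4 := key (v - u)
  simp_rw [map_sub, h3, sub_self, norm_zero, zero_pow two_ne_zero] at h4
  have h5 : ‖v - u‖ ^ 2 = 0 := h4.unique hasSum_zero
  have h6 : v = u := by simpa [sub_eq_zero] using h5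
  convert hu

end IsResolution

end Resolution

/-! ### Spectral measures of the velocity operator in momentum space. -/

section Velocity

variable {K : Type*} [NormedAddCommGroup K] [InnerProductSpace ℂ K] [CompleteSpace K]
  {I : Type*}

theorem measurable_torusRep : Measurable torusRep :=
  measurable_subtype_coe.comp (AddCircle.measurableEquivIco (2 * Real.pi) 0).measurable

theorem coe_torusRep (p : Torus) : (torusRep p : Torus) = p :=
  (AddCircle.equivIco (2 * Real.pi) 0).symm_apply_apply p

theorem lintegral_enorm_sq_latticeFourier (ψ : LatticeSpace K) :
    ∫⁻ p, ‖latticeFourier ψ p‖ₑ ^ 2 ∂(AddCircle.haarAddCircle : Measure Torus) = ‖ψ‖ₑ ^ 2 := by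
  have h := eLpNorm_nnreal_pow_eq_lintegral (p := 2) (f := latticeFourier ψ)
    (μ := (AddCircle.haarAddCircle : Measure Torus)) two_ne_zero
  have h1 : ‖latticeFourier ψ‖ₑ = eLpNorm (latticeFourier ψ) 2 AddCircle.haarAddCircle :=
    Lp.enorm_def _
  have h2 : ‖latticeFourier ψ‖ₑ = ‖ψ‖ₑ := by
    rw [← ofReal_norm, LinearIsometry.norm_map, ofReal_norm]
  rw [← h2, h1]
  norm_num at h
  exact_mod_cast h.symm

/-- The projections of a band structure: resolutions of the identity depending continuously on
the momentum. -/
structure IsBandStructure (Pr : I → ℝ → K →L[ℂ] K) : Prop where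
  isResolution : ∀ p, IsResolution fun k => Pr k p
  continuous : ∀ k, Continuous (Pr k)

/-- `φ = g(V) ψ`, in the momentum representation. -/
def BandRel (ω : I → ℝ → ℝ) (Pr : I → ℝ → K →L[ℂ] K) (g : ℝ → ℂ) (ψ φ : LatticeSpace K) : Prop :=
  ∀ᵐ p ∂(AddCircle.haarAddCircle : Measure Torus),
    HasSum (fun k => g (deriv (ω k) (torusRep p)) • Pr k (torusRep p) (latticeFourier ψ p))
      (latticeFourier φ p)

/-- The spectral measure of the velocity operator in the state `ψ`. -/
def velocityMeasure (ω : I → ℝ → ℝ) (Pr : I → ℝ → K →L[ℂ] K) (ψ : LatticeSpace K) : Measure ℝ :=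
  Measure.sum fun k => ((AddCircle.haarAddCircle : Measure Torus).withDensity fun p =>
    ‖Pr k (torusRep p) (latticeFourier ψ p)‖ₑ ^ 2).map fun p => deriv (ω k) (torusRep p)

namespace IsBandStructure

variable {ω : I → ℝ → ℝ} {Pr : I → ℝ → K →L[ℂ] K}

theorem measurable_velocity (ω : I → ℝ → ℝ) (k : I) :
    Measurable fun p => deriv (ω k) (torusRep p) :=
  (measurable_deriv (ω k)).comp measurable_torusRep

theorem aestronglyMeasurable_apply (hB : IsBandStructure Pr) (k : I) (ψ : LatticeSpace K) :
    AEStronglyMeasurable (fun p => Pr k (torusRep p) (latticeFourier ψ p))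
      (AddCircle.haarAddCircle : Measure Torus) := by
  have h1 : StronglyMeasurable fun p => Pr k (torusRep p) :=
    (hB.continuous k).stronglyMeasurable.comp_measurable measurable_torusRep
  exact (isBoundedBilinearMap_apply (𝕜 := ℂ) (E := K) (F := K)).continuous.comp_aestronglyMeasurable
    (h1.aestronglyMeasurable.prodMk (Lp.aestronglyMeasurable (latticeFourier ψ)))

theorem aemeasurable_enorm_sq (hB : IsBandStructure Pr) (k : I) (ψ : LatticeSpace K) :
    AEMeasurable (fun p => ‖Pr k (torusRep p) (latticeFourier ψ p)‖ₑ ^ 2)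
      (AddCircle.haarAddCircle : Measure Torus) :=
  (hB.aestronglyMeasurable_apply k ψ).enorm.pow_const 2

theorem lintegral_component (hB : IsBandStructure Pr) (ψ : LatticeSpace K) {f : ℝ → ENNReal}
    (hf : Measurable f) (k : I) :
    ∫⁻ t, f t ∂(((AddCircle.haarAddCircle : Measure Torus).withDensity fun p =>
      ‖Pr k (torusRep p) (latticeFourier ψ p)‖ₑ ^ 2).map fun p => deriv (ω k) (torusRep p)) =
      ∫⁻ p, f (deriv (ω k) (torusRep p)) * ‖Pr k (torusRep p) (latticeFourier ψ p)‖ₑ ^ 2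
        ∂AddCircle.haarAddCircle := by
  have hfm : AEMeasurable (fun p => f (deriv (ω k) (torusRep p)))
      (AddCircle.haarAddCircle : Measure Torus) := (hf.comp (measurable_velocity ω k)).aemeasurable
  rw [lintegral_map hf (measurable_velocity ω k), lintegral_withDensity_eq_lintegral_mul₀
    (hB.aemeasurable_enorm_sq k ψ) hfm]
  simp_rw [Pi.mul_apply, mul_comm]

theorem lintegral_velocityMeasure (hB : IsBandStructure Pr) [Countable I] (ψ : LatticeSpace K)
    {f : ℝ → ENNReal} (hf : Measurable f) :
    ∫⁻ t, f t ∂(velocityMeasure ω Pr ψ) = ∫⁻ p, ∑' k, f (deriv (ω k) (torusRep p)) *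
      ‖Pr k (torusRep p) (latticeFourier ψ p)‖ₑ ^ 2 ∂AddCircle.haarAddCircle := by
  rw [velocityMeasure, lintegral_sum_measure]
  simp_rw [hB.lintegral_component ψ hf]
  exact (lintegral_tsum fun k =>
    (hf.comp (measurable_velocity ω k)).aemeasurable.mul (hB.aemeasurable_enorm_sq k ψ)).symm

/-- Parseval in each fibre, integrated over the circle; it gives both the operator bound and the
domain of V. -/
theorem enorm_sq_of_bandRel (hB : IsBandStructure Pr) [Countable I] {g : ℝ → ℂ}
    (hg : Measurable g) {ψ φ : LatticeSpace K} (h : BandRel ω Pr g ψ φ) :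
    ‖φ‖ₑ ^ 2 = ∫⁻ t, ‖g t‖ₑ ^ 2 ∂(velocityMeasure ω Pr ψ) := by
  rw [hB.lintegral_velocityMeasure ψ (by fun_prop), ← lintegral_enorm_sq_latticeFourier]
  refine lintegral_congr_ae ?_
  filter_upwards [h] with p hp
  exact ((hB.isResolution _).tsum_enorm_sq hp).symm

theorem bandRel_one (hB : IsBandStructure Pr) (ψ : LatticeSpace K) :
    BandRel ω Pr (fun _ => 1) ψ ψ := by
  refine Filter.Eventually.of_forall fun p => ?_
  simpa using (hB.isResolution (torusRep p)).hasSum (latticeFourier ψ p)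

theorem velocityMeasure_univ (hB : IsBandStructure Pr) [Countable I] (ψ : LatticeSpace K) :
    velocityMeasure ω Pr ψ Set.univ = ‖ψ‖ₑ ^ 2 := by
  rw [hB.enorm_sq_of_bandRel (ω := ω) measurable_const (hB.bandRel_one ψ)]
  simp

theorem isFiniteMeasure_velocityMeasure (hB : IsBandStructure Pr) [Countable I]
    (ψ : LatticeSpace K) : IsFiniteMeasure (velocityMeasure ω Pr ψ) :=
  ⟨by rw [hB.velocityMeasure_univ]; exact ENNReal.pow_lt_top enorm_lt_top⟩

/-- Finiteness of the integral makes the fibre series square summable, hence convergent, at almost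
every p. Countability of the index set makes the limit of finite partial sums measurable, and
fibrewise Parseval puts it in L². -/
theorem exists_bandRel (hB : IsBandStructure Pr) [Countable I] {g : ℝ → ℂ} (hg : Measurable g)
    {ψ : LatticeSpace K} (h : ∫⁻ t, ‖g t‖ₑ ^ 2 ∂(velocityMeasure ω Pr ψ) < ⊤) :
    ∃ φ, BandRel ω Pr g ψ φ := by
  have hm (k : I) : AEStronglyMeasurable (fun p => g (deriv (ω k) (torusRep p)) •
      Pr k (torusRep p) (latticeFourier ψ p)) (AddCircle.haarAddCircle : Measure Torus) :=
    (hg.comp (measurable_velocity ω k)).aestronglyMeasurable.smul (hB.aestronglyMeasurable_apply k ψ)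
  rw [hB.lintegral_velocityMeasure ψ (by fun_prop)] at h
  have hae := ae_lt_top' (AEMeasurable.tsum fun k =>
    ((by fun_prop : Measurable fun t => ‖g t‖ₑ ^ 2).comp (measurable_velocity ω k)).aemeasurable.mul
      (hB.aemeasurable_enorm_sq k ψ)) h.ne
  set f : Torus → K := fun p => ∑' k, g (deriv (ω k) (torusRep p)) •
    Pr k (torusRep p) (latticeFourier ψ p)
  have hf : ∀ᵐ p ∂(AddCircle.haarAddCircle : Measure Torus),
      HasSum (fun k => g (deriv (ω k) (torusRep p)) •
        Pr k (torusRep p) (latticeFourier ψ p)) (f p) := by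
    filter_upwards [hae] with p hp
    obtain ⟨u, hu⟩ := (hB.isResolution (torusRep p)).exists_hasSum hp.ne
    exact hu.summable.hasSum
  have hfm : AEStronglyMeasurable f AddCircle.haarAddCircle :=
    aestronglyMeasurable_of_tendsto_ae Filter.atTop
      (fun s : Finset I => Finset.aestronglyMeasurable_fun_sum s fun k _ => hm k)
      (by filter_upwards [hf] with p hp using hp)
  have hf2 : MemLp f 2 AddCircle.haarAddCircle := by
    refine ⟨hfm, ?_⟩
    have h1 := eLpNorm_nnreal_pow_eq_lintegral (p := 2) (f := f)
      (μ := (AddCircle.haarAddCircle : Measure Torus)) two_ne_zero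
    have h2 : ∫⁻ p, ‖f p‖ₑ ^ 2 ∂AddCircle.haarAddCircle < ⊤ := by
      refine (lintegral_congr_ae ?_).trans_lt h
      filter_upwards [hf] with p hp
      exact ((hB.isResolution _).tsum_enorm_sq hp).symm
    norm_num at h1
    rw [← h1] at h2
    exact (ENNReal.pow_lt_top_iff.1 h2).resolve_right two_ne_zero
  refine ⟨fourierEquiv.symm (hf2.toLp f), ?_⟩
  rw [BandRel, latticeFourier_fourierEquiv_symm]
  filter_upwards [hf, hf2.coeFn_toLp] with p h1 h2
  rwa [h2]

theorem bandRel_unique {g : ℝ → ℂ} {ψ φ φ' : LatticeSpace K} (h : BandRel ω Pr g ψ φ)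
    (h' : BandRel ω Pr g ψ φ') : φ = φ' := by
  apply (latticeFourier (K := K)).injective
  rw [Lp.ext_iff]
  filter_upwards [h, h'] with p h1 h2
  exact h1.unique h2

theorem inner_of_bandRel (hB : IsBandStructure Pr) [Countable I] {g : ℝ → ℂ} (hg : Measurable g)
    {ψ φ : LatticeSpace K} (h : BandRel ω Pr g ψ φ) (hi : Integrable g (velocityMeasure ω Pr ψ)) :
    inner ℂ ψ φ = ∫ t, g t ∂(velocityMeasure ω Pr ψ) := by
  have hm (k : I) : AEStronglyMeasurable (fun p => g (deriv (ω k) (torusRep p)) *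
      ((‖Pr k (torusRep p) (latticeFourier ψ p)‖ ^ 2 : ℝ) : ℂ))
      (AddCircle.haarAddCircle : Measure Torus) :=
    (hg.comp (measurable_velocity ω k)).aestronglyMeasurable.mul
      (Complex.continuous_ofReal.comp_aestronglyMeasurable
        ((hB.aestronglyMeasurable_apply k ψ).norm.pow 2))
  have e1 : ∀ᵐ p ∂(AddCircle.haarAddCircle : Measure Torus),
      inner ℂ (latticeFourier ψ p) (latticeFourier φ p) = ∑' k, g (deriv (ω k) (torusRep p)) *
      ((‖Pr k (torusRep p) (latticeFourier ψ p)‖ ^ 2 : ℝ) : ℂ) := by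
    filter_upwards [h] with p hp
    rw [← ((hB.isResolution _).hasSum_inner (w := latticeFourier ψ p) hp).tsum_eq]
    congr 1; funext k
    rw [inner_self_eq_norm_sq_to_K]
    norm_cast
  have e2 : ∑' k, ∫⁻ p, ‖g (deriv (ω k) (torusRep p)) *
      ((‖Pr k (torusRep p) (latticeFourier ψ p)‖ ^ 2 : ℝ) : ℂ)‖ₑ
        ∂(AddCircle.haarAddCircle : Measure Torus) ≠ ⊤ := by
    have h1 := hi.2
    rw [hasFiniteIntegral_iff_enorm, velocityMeasure, lintegral_sum_measure] at h1
    simp_rw [hB.lintegral_component ψ (hg.enorm)] at h1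
    convert h1.ne using 5 with k p
    rw [enorm_mul]
    congr 1
    rw [← ofReal_norm, Complex.norm_real, ← ofReal_norm, ← ENNReal.ofReal_pow (norm_nonneg _),
      Real.norm_eq_abs, abs_of_nonneg (sq_nonneg _)]
  rw [← latticeFourier.inner_map_map, L2.inner_def, integral_congr_ae e1, integral_tsum hm e2]
  refine HasSum.tsum_eq ((hasSum_integral_measure hi).congr_fun fun k => ?_)
  rw [integral_map (measurable_velocity ω k).aemeasurable hg.aestronglyMeasurable,
    integral_withDensity_eq_integral_toReal_smul₀ (hB.aemeasurable_enorm_sq k ψ)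
      (Filter.Eventually.of_forall fun p => ENNReal.pow_lt_top enorm_lt_top)]
  congr 1; funext p
  rw [ENNReal.toReal_pow, toReal_enorm, Complex.real_smul, mul_comm]

end IsBandStructure

end Velocity

/-! ### Functional calculus of the velocity operator. -/

section VelocityCalculus

variable {K : Type*} [NormedAddCommGroup K] [InnerProductSpace ℂ K] [CompleteSpace K]
  {I : Type*} {ω : I → ℝ → ℝ} {Pr : I → ℝ → K →L[ℂ] K}

open Classical in
/-- The Borel functional calculus of the velocity operator. -/
def velocityCalculus (ω : I → ℝ → ℝ) (Pr : I → ℝ → K →L[ℂ] K) (g : ℝ → ℂ) :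
    LatticeSpace K →L[ℂ] LatticeSpace K :=
  if h : ∃ T : LatticeSpace K →L[ℂ] LatticeSpace K, ∀ ψ, BandRel ω Pr g ψ (T ψ) then h.choose else 0

theorem BandRel.add {g : ℝ → ℂ} {ψ ψ' φ φ' : LatticeSpace K} (h : BandRel ω Pr g ψ φ)
    (h' : BandRel ω Pr g ψ' φ') : BandRel ω Pr g (ψ + ψ') (φ + φ') := by
  rw [BandRel, map_add, map_add]
  filter_upwards [h, h', Lp.coeFn_add (latticeFourier ψ) (latticeFourier ψ'),
    Lp.coeFn_add (latticeFourier φ) (latticeFourier φ')] with p h1 h2 h3 h4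
  rw [h3, h4]
  simpa using h1.add h2

theorem BandRel.smul {g : ℝ → ℂ} {ψ φ : LatticeSpace K} (h : BandRel ω Pr g ψ φ) (c : ℂ) :
    BandRel ω Pr g (c • ψ) (c • φ) := by
  rw [BandRel, map_smul, map_smul]
  filter_upwards [h, Lp.coeFn_smul c (latticeFourier ψ), Lp.coeFn_smul c (latticeFourier φ)]
    with p h1 h3 h4
  rw [h3, h4]
  simpa [smul_comm c] using h1.const_smul c

namespace IsBandStructure

theorem norm_le_of_bandRel (hB : IsBandStructure Pr) [Countable I] {g : ℝ → ℂ} (hg : Measurable g)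
    {C : ℝ} (hC : ∀ t, ‖g t‖ ≤ C) {ψ φ : LatticeSpace K} (h : BandRel ω Pr g ψ φ) :
    ‖φ‖ ≤ C * ‖ψ‖ := by
  have hC0 : 0 ≤ C := (norm_nonneg _).trans (hC 0)
  have h1 : ‖φ‖ₑ ^ 2 ≤ (ENNReal.ofReal C * ‖ψ‖ₑ) ^ 2 := by
    rw [hB.enorm_sq_of_bandRel hg h, mul_pow, ← hB.velocityMeasure_univ (ω := ω),
      ← lintegral_const]
    refine lintegral_mono fun t => ?_
    gcongr
    rw [← ofReal_norm]
    exact ENNReal.ofReal_le_ofReal (hC t)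
  have h2 := (ENNReal.pow_le_pow_left_iff two_ne_zero).1 h1
  rw [← ofReal_norm, ← ofReal_norm, ← ENNReal.ofReal_mul hC0] at h2
  exact (ENNReal.ofReal_le_ofReal_iff (by positivity)).1 h2

theorem velocityCalculus_spec (hB : IsBandStructure Pr) [Countable I] {g : ℝ → ℂ}
    (hg : IsBoundedBorel g) (ψ : LatticeSpace K) :
    BandRel ω Pr g ψ (velocityCalculus ω Pr g ψ) := by
  obtain ⟨C, hC⟩ := hg.bounded
  have hex (ψ : LatticeSpace K) : ∃ φ, BandRel ω Pr g ψ φ := by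
    refine hB.exists_bandRel hg.measurable ?_
    have := hB.isFiniteMeasure_velocityMeasure (ω := ω) ψ
    refine (lintegral_mono (g := fun _ => ENNReal.ofReal C ^ 2) fun t => ?_).trans_lt ?_
    · change ‖g t‖ₑ ^ 2 ≤ ENNReal.ofReal C ^ 2
      gcongr
      rw [← ofReal_norm]
      exact ENNReal.ofReal_le_ofReal (hC t)
    · rw [lintegral_const]
      exact ENNReal.mul_lt_top (ENNReal.pow_lt_top ENNReal.ofReal_lt_top) (measure_lt_top _ _)
  choose T hT using hex
  have h : ∃ T : LatticeSpace K →L[ℂ] LatticeSpace K, ∀ ψ, BandRel ω Pr g ψ (T ψ) :=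
    ⟨LinearMap.mkContinuous
      { toFun := T
        map_add' := fun ψ ψ' => bandRel_unique (hT _) ((hT ψ).add (hT ψ'))
        map_smul' := fun c ψ => bandRel_unique (hT _) ((hT ψ).smul c) } C
      fun ψ => hB.norm_le_of_bandRel hg.measurable hC (hT ψ), hT⟩
  rw [velocityCalculus, dif_pos h]
  exact h.choose_spec ψ

theorem velocityCalculus_eq (hB : IsBandStructure Pr) [Countable I] {g : ℝ → ℂ}
    (hg : IsBoundedBorel g) {ψ φ : LatticeSpace K} (h : BandRel ω Pr g ψ φ) :
    velocityCalculus ω Pr g ψ = φ :=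
  bandRel_unique (hB.velocityCalculus_spec hg ψ) h

theorem bandRel_mul (hB : IsBandStructure Pr) {g h : ℝ → ℂ} {ψ φ χ : LatticeSpace K}
    (hh : BandRel ω Pr h ψ φ) (hg : BandRel ω Pr g φ χ) :
    BandRel ω Pr (fun t => g t * h t) ψ χ := by
  filter_upwards [hh, hg] with p h1 h2
  refine h2.congr_fun fun k => ?_
  rw [(hB.isResolution _).apply_of_hasSum h1, smul_smul]

theorem inner_bandRel_star (hB : IsBandStructure Pr) {g : ℝ → ℂ} {ψ ψ' φ φ' : LatticeSpace K}
    (h : BandRel ω Pr (fun t => star (g t)) ψ ψ') (h' : BandRel ω Pr g φ φ') :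
    inner ℂ ψ' φ = inner ℂ ψ φ' := by
  rw [← latticeFourier.inner_map_map ψ' φ, ← latticeFourier.inner_map_map ψ φ', L2.inner_def, L2.inner_def]
  refine integral_congr_ae ?_
  filter_upwards [h, h'] with p h1 h2
  have h3 := (hB.isResolution _).hasSum_inner (w := latticeFourier ψ p) h2
  have h4 := (hB.isResolution _).hasSum_inner (w := latticeFourier φ p) h1
  have h5 := h4.star
  rw [Complex.star_def, inner_conj_symm] at h5
  refine h5.unique (h3.congr_fun fun k => ?_)
  simp only [map_mul, Complex.conj_conj, inner_conj_symm]

/-- `Submodule.toLinearPMap` recovers its graph only if that graph is single-valued, which holds by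
uniqueness of sums. -/
theorem velocityOp_spec {ψ : LatticeSpace K} (h : ψ ∈ (velocityOp ω Pr).domain) :
    BandRel ω Pr (fun t => (t : ℂ)) ψ (velocityOp ω Pr ⟨ψ, h⟩) := by
  have := Submodule.mem_graph_toLinearPMap (g := velocityGraph ω Pr)
    (fun x hx h0 => by
      have h1 : BandRel ω Pr (fun t => (t : ℂ)) x.1 x.2 := hx
      rw [h0] at h1
      refine bandRel_unique h1 ?_
      rw [BandRel, map_zero]
      filter_upwards [Lp.coeFn_zero K 2 (AddCircle.haarAddCircle : Measure Torus)] with p hp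
      rw [hp]
      simp) ⟨ψ, h⟩
  exact this

theorem mem_velocityOp_domain {ψ φ : LatticeSpace K}
    (h : BandRel ω Pr (fun t => (t : ℂ)) ψ φ) : ψ ∈ (velocityOp ω Pr).domain :=
  Submodule.mem_map.2 ⟨(ψ, φ), h, rfl⟩

theorem isBorelCalculus_velocity (hB : IsBandStructure Pr) [Countable I] :
    IsBorelCalculus (velocityOp ω Pr) (velocityCalculus ω Pr) where
  map_one := by
    ext1 ψ
    exact hB.velocityCalculus_eq (.const 1) (hB.bandRel_one ψ)
  map_mul g h hg hh := by
    ext1 ψ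
    exact hB.velocityCalculus_eq (hg.mul hh) (hB.bandRel_mul (hB.velocityCalculus_spec hh ψ)
      (hB.velocityCalculus_spec hg _))
  map_star g hg := by
    rw [ContinuousLinearMap.star_eq_adjoint, ContinuousLinearMap.eq_adjoint_iff]
    exact fun ψ φ => hB.inner_bandRel_star (hB.velocityCalculus_spec hg.star ψ)
      (hB.velocityCalculus_spec hg φ)
  measure ψ := by
    have hfin := hB.isFiniteMeasure_velocityMeasure (ω := ω) ψ
    have e (t : ℝ) : ENNReal.ofReal (t ^ 2) = ‖(t : ℂ)‖ₑ ^ 2 := by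
      rw [← ofReal_norm, Complex.norm_real, ← ENNReal.ofReal_pow (norm_nonneg _), Real.norm_eq_abs,
        sq_abs]
    have hm : Measurable fun t : ℝ => (t : ℂ) := Complex.measurable_ofReal
    have hdom : ψ ∈ (velocityOp ω Pr).domain ↔
        ∫⁻ t, ENNReal.ofReal (t ^ 2) ∂(velocityMeasure ω Pr ψ) < ⊤ := by
      simp_rw [e]
      constructor
      · intro h
        rw [← hB.enorm_sq_of_bandRel hm (velocityOp_spec h)]
        exact ENNReal.pow_lt_top enorm_lt_top
      · intro h
        obtain ⟨φ, hφ⟩ := hB.exists_bandRel hm h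
        exact mem_velocityOp_domain hφ
    refine ⟨velocityMeasure ω Pr ψ, hfin, fun g hg => ?_, hdom, fun h => ?_⟩
    · exact hB.inner_of_bandRel hg.measurable (hB.velocityCalculus_spec hg ψ) (hg.integrable _)
    · rw [hB.inner_of_bandRel hm (velocityOp_spec h)
        (IsSpectralMeasure.integrable_id (hdom.1 h)).ofReal, integral_complex_ofReal]
  apply_sub c g hg hcg ψ := by
    have h1 := hB.velocityCalculus_spec (ω := ω) hg ψ
    have h2 := hB.velocityCalculus_spec (ω := ω) hcg ψ
    have h3 : BandRel ω Pr (fun t => (t : ℂ)) (velocityCalculus ω Pr g ψ)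
        (velocityCalculus ω Pr (fun t => ((t : ℂ) - c) * g t) ψ +
          (c : ℂ) • velocityCalculus ω Pr g ψ) := by
      have h4 := h1.smul c
      rw [BandRel, map_add]
      rw [BandRel] at h4
      filter_upwards [h1, h2, h4, Lp.coeFn_smul (c : ℂ) (latticeFourier ψ),
        Lp.coeFn_add (latticeFourier (velocityCalculus ω Pr (fun t => ((t : ℂ) - c) * g t) ψ))
          (latticeFourier ((c : ℂ) • velocityCalculus ω Pr g ψ))] with p h5 h6 h7 h8 h9
      rw [h9]
      rw [map_smul, h8] at h7
      refine (h6.add h7).congr_fun fun k => ?_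
      rw [(hB.isResolution _).apply_of_hasSum h5, Pi.smul_apply, map_smul, smul_smul, smul_smul,
        ← add_smul]
      congr 1
      ring
    refine ⟨mem_velocityOp_domain h3, ?_⟩
    rw [sub_eq_iff_eq_add]
    exact bandRel_unique (velocityOp_spec _) h3

end IsBandStructure

end VelocityCalculus

/-! ### Fibrewise comparison of the two dynamics. -/

section Fibre

variable {K : Type*} [NormedAddCommGroup K] [InnerProductSpace ℂ K] [CompleteSpace K]
  {I : Type*} {ω : I → ℝ → ℝ} {Pr : I → ℝ → K →L[ℂ] K} {What : Torus → unitary (K →L[ℂ] K)}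

theorem norm_unitary_apply (U : unitary (K →L[ℂ] K)) (v : K) : ‖(U : K →L[ℂ] K) v‖ = ‖v‖ :=
  ContinuousLinearMap.norm_map_of_mem_unitary U.2 v

theorem hasSum_pow_apply {π : I → K →L[ℂ] K} (hπ : IsResolution π) {θ : I → ℝ} {U : K →L[ℂ] K}
    (h : ∀ v, HasSum (fun k => Complex.exp (Complex.I * θ k) • π k v) (U v)) (n : ℕ) (v : K) :
    HasSum (fun k => Complex.exp (((n * θ k : ℝ) : ℂ) * Complex.I) • π k v) ((U ^ n) v) := by
  induction n with
  | zero => simpa using hπ.hasSum v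
  | succ n ih =>
    rw [pow_succ', mul_apply_eq_comp]
    refine (h _).congr_fun fun k => ?_
    rw [hπ.apply_of_hasSum ih, smul_smul, ← Complex.exp_add]
    congr 2
    push_cast
    ring

/-- Mean value inequality applied twice; the sharper factor 1/2 is not needed. -/
theorem abs_sub_sub_le_of_deriv2 {f : ℝ → ℝ} (hf : ContDiff ℝ 2 f) {M : ℝ}
    (hM : ∀ p, ‖iteratedDeriv 2 f p‖ ≤ M) (x s : ℝ) :
    |f (x + s) - f x - s * deriv f x| ≤ M * s ^ 2 := by
  have hd : Differentiable ℝ f := hf.differentiable (by norm_num)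
  have hd' : Differentiable ℝ (deriv f) := by
    have := hf.differentiable_iteratedDeriv 1 (by norm_num)
    rwa [iteratedDeriv_one] at this
  have hM' (p : ℝ) : ‖deriv (deriv f) p‖ ≤ M := by
    have := hM p
    rwa [iteratedDeriv_succ, iteratedDeriv_one] at this
  have h1 (y : ℝ) : ‖deriv f y - deriv f x‖ ≤ M * ‖y - x‖ :=
    Convex.norm_image_sub_le_of_norm_deriv_le (fun z _ => hd' z) (fun z _ => hM' z) convex_univ
      (Set.mem_univ x) (Set.mem_univ y)
  have hM0 : 0 ≤ M := (norm_nonneg _).trans (hM 0)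
  have h2 := Convex.norm_image_sub_le_of_norm_hasDerivWithin_le (f := fun y => f y - y * deriv f x)
    (f' := fun y => deriv f y - deriv f x) (s := Set.uIcc x (x + s)) (C := M * |s|) (x := x)
    (y := x + s) (fun y _ => by
      have := ((hd y).hasDerivAt.sub ((hasDerivAt_id y).mul_const (deriv f x))).hasDerivWithinAt
        (s := Set.uIcc x (x + s))
      rw [one_mul] at this
      exact this) (fun y hy => by
      refine (h1 y).trans ?_
      gcongr
      have := Set.abs_sub_left_of_mem_uIcc hy
      simpa using this) (convex_uIcc _ _) Set.left_mem_uIcc Set.right_mem_uIcc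
  rw [Real.norm_eq_abs, Real.norm_eq_abs] at h2
  calc _ = |f (x + s) - (x + s) * deriv f x - (f x - x * deriv f x)| := by congr 1; ring
    _ ≤ _ := h2
    _ = _ := by rw [add_sub_cancel_left, mul_assoc, ← sq, sq_abs]

theorem norm_exp_sub_exp_le (a b : ℝ) :
    ‖Complex.exp (a * Complex.I) - Complex.exp (b * Complex.I)‖ ≤ |a - b| := by
  have e : Complex.exp (a * Complex.I) - Complex.exp (b * Complex.I) =
      Complex.exp (b * Complex.I) * (Complex.exp (Complex.I * ((a - b : ℝ) : ℂ)) - 1) := by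
    rw [mul_sub, ← Complex.exp_add, mul_one]
    congr 2
    push_cast
    ring
  rw [e, norm_mul, Complex.norm_exp_ofReal_mul_I, one_mul]
  exact Real.norm_exp_I_mul_ofReal_sub_one_le

/-- Comparison of the fibres of `W^{-n} e^{isX} W^n e^{-isX}` and `e^{insV}`. -/
theorem norm_fibre_sub_le (hB : IsBandStructure Pr)
    (hband : ∀ (p : ℝ) (v : K), HasSum (fun k => Complex.exp (Complex.I * (ω k p : ℂ)) • Pr k p v)
      ((What (p : Torus) : K →L[ℂ] K) v))
    (hω : ∀ k, ContDiff ℝ 2 (ω k)) {M : ℝ} (hM0 : 0 ≤ M)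
    (hM : ∀ k p, ‖iteratedDeriv 2 (ω k) p‖ ≤ M)
    (hPr : ∀ k, ContDiff ℝ 1 (Pr k)) {S : I → ℝ} (hS : Summable S)
    (hSP : ∀ k p, ‖deriv (Pr k) p‖ ≤ S k) (n : ℕ) (x s : ℝ) {v u : K}
    (hu : HasSum (fun k => Complex.exp (((n * s * deriv (ω k) x : ℝ) : ℂ) * Complex.I) •
      Pr k x v) u) :
    ‖((What ((x + s : ℝ) : Torus) : K →L[ℂ] K) ^ n) v - ((What (x : Torus) : K →L[ℂ] K) ^ n) u‖ ≤
      ((∑' k, S k) * |s| + n * M * s ^ 2) * ‖v‖ := by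
  have h1 := hasSum_pow_apply (hB.isResolution (x + s)) (hband (x + s)) n v
  have h2 := hasSum_pow_apply (hB.isResolution x) (hband x) n u
  simp_rw [(hB.isResolution x).apply_of_hasSum hu, smul_smul, ← Complex.exp_add] at h2
  -- Intermediate vector: phases taken at x + s, projections still at x. The two replacements are
  -- then estimated separately.
  obtain ⟨a, ha⟩ : ∃ a, HasSum (fun k =>
      Complex.exp (((n * ω k (x + s) : ℝ) : ℂ) * Complex.I) • Pr k x v) a := by
    refine (hB.isResolution x).summable_of_summable_norm_sq ?_
    simp_rw [Complex.norm_exp_ofReal_mul_I, one_pow, one_mul]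
    exact ((hB.isResolution x).hasSum_norm_sq_apply v).summable
  have h3 := h1.sub ha
  have h4 := ha.sub h2
  -- The differences Πₖ(x+s) - Πₖ(x) need not be mutually orthogonal, so their norms are summed;
  -- this uses summability of sup‖Πₖ'‖.
  have b1 : ‖((What ((x + s : ℝ) : Torus) : K →L[ℂ] K) ^ n) v - a‖ ≤
      ((∑' k, S k) * |s|) * ‖v‖ := by
    rw [← h3.tsum_eq]
    refine tsum_of_norm_bounded ((hS.hasSum.mul_right |s|).mul_right ‖v‖) fun k => ?_
    rw [← smul_sub, norm_smul, Complex.norm_exp_ofReal_mul_I, one_mul,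
      ← sub_apply]
    refine (ContinuousLinearMap.le_opNorm _ _).trans ?_
    gcongr
    have := Convex.norm_image_sub_le_of_norm_deriv_le (𝕜 := ℝ) (f := Pr k) (C := S k)
      (fun z _ => ((hPr k).differentiable (by norm_num)) z) (fun z _ => hSP k z) convex_univ
      (Set.mem_univ x) (Set.mem_univ (x + s))
    rwa [add_sub_cancel_left, Real.norm_eq_abs] at this
  -- Here all projections are at the same point, so orthogonality replaces the sum by a supremum and
  -- a uniform bound on ωₖ'' suffices.
  have b2 : ‖a - ((What (x : Torus) : K →L[ℂ] K) ^ n) u‖ ≤ (n * M * s ^ 2) * ‖v‖ := by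
    simp_rw [← sub_smul] at h4
    refine (hB.isResolution x).norm_le_of_hasSum (by positivity) (fun k => ?_) h4
    rw [← add_mul, ← Complex.ofReal_add]
    refine (norm_exp_sub_exp_le _ _).trans ?_
    have e : n * ω k (x + s) - (n * ω k x + n * s * deriv (ω k) x) =
      n * (ω k (x + s) - ω k x - s * deriv (ω k) x) := by ring
    rw [e, abs_mul, Nat.abs_cast, mul_assoc]
    gcongr
    exact abs_sub_sub_le_of_deriv2 (hω k) (hM k) x s
  calc _ = ‖(((What ((x + s : ℝ) : Torus) : K →L[ℂ] K) ^ n) v - a) +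
        (a - ((What (x : Torus) : K →L[ℂ] K) ^ n) u)‖ := by rw [sub_add_sub_cancel]
    _ ≤ _ := norm_add_le _ _
    _ ≤ _ := by rw [add_mul]; exact add_le_add b1 b2

end Fibre

/-! ### Comparison of characteristic functions and conclusion. -/

section Main

variable {K : Type*} [NormedAddCommGroup K] [InnerProductSpace ℂ K] [CompleteSpace K]
  {I : Type*} {ω : I → ℝ → ℝ} {Pr : I → ℝ → K →L[ℂ] K} {What : Torus → unitary (K →L[ℂ] K)}
  {W : LatticeSpace K ≃ₗᵢ[ℂ] LatticeSpace K}

theorem latticeFourier_pow_apply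
    (hfib : ∀ ψ : LatticeSpace K, ∀ᵐ p ∂(AddCircle.haarAddCircle : Measure Torus),
      latticeFourier (W ψ) p = (What p : K →L[ℂ] K) (latticeFourier ψ p)) (n : ℕ)
    (ψ : LatticeSpace K) : ∀ᵐ p ∂(AddCircle.haarAddCircle : Measure Torus),
      latticeFourier ((W ^ n) ψ) p = ((What p : K →L[ℂ] K) ^ n) (latticeFourier ψ p) := by
  induction n with
  | zero => exact Filter.Eventually.of_forall fun p => by simp
  | succ n ih =>
    filter_upwards [ih, hfib ((W ^ n) ψ)] with p h1 h2
    rw [pow_succ' (What p : K →L[ℂ] K), mul_apply_eq_comp, ← h1, ← h2, pow_succ']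
    rfl

theorem norm_le_of_latticeFourier_le {χ a b : LatticeSpace K} {δ : ℝ} (hδ : 0 ≤ δ)
    (h : ∀ᵐ p ∂(AddCircle.haarAddCircle : Measure Torus),
      ‖latticeFourier χ p‖ ≤ ‖latticeFourier a p‖ + δ * ‖latticeFourier b p‖) :
    ‖χ‖ ≤ ‖a‖ + δ * ‖b‖ := by
  have hn (ψ : LatticeSpace K) : eLpNorm (fun p => ‖latticeFourier ψ p‖) 2
      (AddCircle.haarAddCircle : Measure Torus) = ENNReal.ofReal ‖ψ‖ := by
    rw [eLpNorm_norm, ← Lp.enorm_def, ← ofReal_norm, LinearIsometry.norm_map]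
  have h1 := (eLpNorm_mono_ae_real h).trans (eLpNorm_add_le (p := 2)
    (Lp.aestronglyMeasurable (latticeFourier a)).norm
    ((Lp.aestronglyMeasurable (latticeFourier b)).norm.const_mul δ) (by norm_num))
  have h2 : eLpNorm (fun p => δ * ‖latticeFourier b p‖) 2
      (AddCircle.haarAddCircle : Measure Torus) = ENNReal.ofReal (δ * ‖b‖) := by
    have := eLpNorm_const_smul δ (fun p => ‖latticeFourier b p‖) 2
      (AddCircle.haarAddCircle : Measure Torus)
    rw [hn, ← ofReal_norm, Real.norm_eq_abs, abs_of_nonneg hδ, ← ENNReal.ofReal_mul hδ] at this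
    exact this
  rw [h2, hn, ← eLpNorm_norm, hn, ← ENNReal.ofReal_add (norm_nonneg _) (by positivity)] at h1
  exact (ENNReal.ofReal_le_ofReal_iff (by positivity)).1 h1

/-- Comparison of the characteristic functions of `Xₙ` and `V` in a pure state. -/
theorem norm_inner_sub_inner_le [Countable I] (hB : IsBandStructure Pr)
    (hfib : ∀ ψ : LatticeSpace K, ∀ᵐ p ∂(AddCircle.haarAddCircle : Measure Torus),
      latticeFourier (W ψ) p = (What p : K →L[ℂ] K) (latticeFourier ψ p))
    (hband : ∀ (p : ℝ) (v : K), HasSum (fun k => Complex.exp (Complex.I * (ω k p : ℂ)) • Pr k p v)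
      ((What (p : Torus) : K →L[ℂ] K) v))
    (hω : ∀ k, ContDiff ℝ 2 (ω k)) {M : ℝ} (hM0 : 0 ≤ M)
    (hM : ∀ k p, ‖iteratedDeriv 2 (ω k) p‖ ≤ M)
    (hPr : ∀ k, ContDiff ℝ 1 (Pr k)) {S : I → ℝ} (hS0 : ∀ k, 0 ≤ S k) (hS : Summable S)
    (hSP : ∀ k p, ‖deriv (Pr k) p‖ ≤ S k) {n : ℕ} (hn : 1 ≤ n) (s : ℝ) (ψ : LatticeSpace K) :
    ‖inner ℂ ψ (positionCalculus W n
        (fun t => Complex.exp (((n * s : ℝ) : ℂ) * t * Complex.I)) ψ) -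
      inner ℂ ψ (velocityCalculus ω Pr
        (fun t => Complex.exp (((n * s : ℝ) : ℂ) * t * Complex.I)) ψ)‖ ≤
      ‖ψ‖ * (‖phaseOp s ψ - ψ‖ + ((∑' k, S k) * |s| + n * M * s ^ 2) * ‖ψ‖) := by
  have hn0 : (n : ℂ) ≠ 0 := by
    have : (0 : ℝ) < n := by positivity
    exact_mod_cast this.ne'
  set g : ℝ → ℂ := fun t => Complex.exp (((n * s : ℝ) : ℂ) * t * Complex.I)
  set φ := velocityCalculus ω Pr g ψ with hφ
  have e1 : (W ^ n) (positionCalculus W n g ψ) = phaseOp s ((W ^ n) ψ) := by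
    rw [positionCalculus_apply, LinearIsometryEquiv.apply_symm_apply, phaseOp]
    congr 2
    funext k
    change Complex.exp _ = Complex.exp _
    congr 1
    push_cast
    field_simp
  have hδ : 0 ≤ (∑' k, S k) * |s| + n * M * s ^ 2 := by
    have : 0 ≤ ∑' k, S k := tsum_nonneg hS0
    positivity
  -- Applying the unitary W^n removes W^{-n}; the difference can then be estimated pointwise in
  -- momentum.
  have key : ‖phaseOp s ((W ^ n) ψ) - (W ^ n) φ‖ ≤
      ‖phaseOp s ψ - ψ‖ + ((∑' k, S k) * |s| + n * M * s ^ 2) * ‖ψ‖ := by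
    refine norm_le_of_latticeFourier_le hδ ?_
    rw [map_sub, map_sub]
    have hmp := measurePreserving_add_right (AddCircle.haarAddCircle : Measure Torus) (s : Torus)
    filter_upwards [Lp.coeFn_sub (latticeFourier (phaseOp s ((W ^ n) ψ)))
        (latticeFourier ((W ^ n) φ)),
      Lp.coeFn_sub (latticeFourier (phaseOp s ψ)) (latticeFourier ψ),
      latticeFourier_phaseOp s ((W ^ n) ψ), latticeFourier_phaseOp s ψ,
      hmp.quasiMeasurePreserving.ae (latticeFourier_pow_apply hfib n ψ),
      latticeFourier_pow_apply hfib n φ,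
      hB.velocityCalculus_spec (ω := ω) (.exp (n * s)) ψ] with p h1 h2 h3 h4 h5 h6 h7
    rw [h1, h2, Pi.sub_apply, Pi.sub_apply, h3, h4, h5, h6]
    set f := latticeFourier ψ
    have h8 : HasSum (fun k => Complex.exp
        (((n * s * deriv (ω k) (torusRep p) : ℝ) : ℂ) * Complex.I) • Pr k (torusRep p) (f p))
        (latticeFourier φ p) := by
      refine h7.congr_fun fun k => ?_
      congr 2
      push_cast
      ring
    have h9 := norm_fibre_sub_le hB hband hω hM0 hM hPr hS hSP n (torusRep p) s h8
    -- The shifted real representative may leave [0, 2π). This is harmless because bands and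
    -- projections live on the real line; only Ŵ has to be periodic.
    have e2 : ((torusRep p + s : ℝ) : Torus) = p + (s : Torus) := by
      rw [AddCircle.coe_add, coe_torusRep]
    rw [e2, coe_torusRep] at h9
    have hU : ‖((What (p + (s : Torus)) : K →L[ℂ] K) ^ n) (f (p + s) - f p)‖ =
        ‖f (p + s) - f p‖ := by
      have := norm_unitary_apply (What (p + (s : Torus)) ^ n) (f (p + s) - f p)
      rwa [SubmonoidClass.coe_pow] at this
    calc _ = ‖((What (p + (s : Torus)) : K →L[ℂ] K) ^ n) (f (p + s) - f p) +
          (((What (p + (s : Torus)) : K →L[ℂ] K) ^ n) (f p) -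
            ((What p : K →L[ℂ] K) ^ n) (latticeFourier φ p))‖ := by
          rw [map_sub, sub_add_sub_cancel]
      _ ≤ _ := norm_add_le _ _
      _ ≤ _ := by rw [hU]; exact add_le_add le_rfl h9
  rw [← inner_sub_right]
  refine (norm_inner_le_norm _ _).trans ?_
  gcongr
  refine le_trans (le_of_eq ?_) key
  rw [← (W ^ n).norm_map, map_sub, e1]

end Main

end

theorem theorem2p1 {K : Type*} [NormedAddCommGroup K] [InnerProductSpace ℂ K] [CompleteSpace K]
    {I : Type*} [Countable I]
    -- the translation-invariant time step operator and its fibres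
    (W : LatticeSpace K ≃ₗᵢ[ℂ] LatticeSpace K)
    (hshift : ∀ ψ, W (rightShift ψ) = rightShift (W ψ))
    (What : Torus → unitary (K →L[ℂ] K))
    (hfib : ∀ ψ : LatticeSpace K, ∀ᵐ p ∂(AddCircle.haarAddCircle : Measure Torus),
      latticeFourier (W ψ) p = (What p : K →L[ℂ] K) (latticeFourier ψ p))
    -- the spectral decomposition of the fibres, on the real line covering the circle
    (ω : I → ℝ → ℝ) (Pr : I → ℝ → K →L[ℂ] K)
    (hproj : ∀ k p, IsStarProjection (Pr k p))
    (horth : ∀ p j k, j ≠ k → Pr j p * Pr k p = 0)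
    (hband : ∀ (p : ℝ) (v : K),
      HasSum (fun k => Complex.exp (Complex.I * (ω k p : ℂ)) • Pr k p v)
        ((What (p : Torus) : K →L[ℂ] K) v))
    -- regularity
    (hω : ∀ k, ContDiff ℝ 2 (ω k))
    (hPr : ∀ k, ContDiff ℝ 1 (Pr k))
    (hPr' : ∑' k, ⨆ p : ℝ, ‖deriv (Pr k) p‖ₑ < ⊤)
    (hω'' : ⨆ (k : I) (p : ℝ), ‖iteratedDeriv 2 (ω k) p‖ₑ < ⊤)
    -- the initial state
    (ρ : LatticeSpace K →L[ℂ] LatticeSpace K) (hρ : IsDensityMatrix ρ)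
    (hX : traceAbsPosition ρ < ⊤) :
    ∃ C : ℝ, 0 < C ∧ ∀ n : ℕ, 1 ≤ n →
      levyDist (opCDF ρ (rescaledPositionOp W n)) (opCDF ρ (velocityOp ω Pr)) ≤
        C * (n : ℝ) ^ (-(1 / 3) : ℝ) := by
  have hB : IsBandStructure Pr :=
    ⟨fun p => .of_unitary (fun k => hproj k p) (horth p) (norm_unitary_apply (What (p : Torus)))
      (hband p), fun k => (hPr k).continuous⟩
  -- real bounds on the derivatives
  set S : I → ℝ := fun k => (⨆ p : ℝ, ‖deriv (Pr k) p‖ₑ).toReal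
  have hS0 : ∀ k, 0 ≤ S k := fun k => ENNReal.toReal_nonneg
  have hS : Summable S := ENNReal.summable_toReal hPr'.ne
  have hSP : ∀ k p, ‖deriv (Pr k) p‖ ≤ S k := fun k p => by
    rw [← toReal_enorm]
    exact ENNReal.toReal_mono (ENNReal.ne_top_of_tsum_ne_top hPr'.ne k)
      (le_iSup (fun p => ‖deriv (Pr k) p‖ₑ) p)
  set M : ℝ := (⨆ (k : I) (p : ℝ), ‖iteratedDeriv 2 (ω k) p‖ₑ).toReal
  have hM0 : 0 ≤ M := ENNReal.toReal_nonneg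
  have hM : ∀ k p, ‖iteratedDeriv 2 (ω k) p‖ ≤ M := fun k p => by
    rw [← toReal_enorm]
    exact ENNReal.toReal_mono hω''.ne
      (le_iSup₂ (f := fun k p => ‖iteratedDeriv 2 (ω k) p‖ₑ) k p)
  set S' := ∑' k, S k
  have hS' : 0 ≤ S' := tsum_nonneg hS0
  -- the pure states composing `ρ`
  set ψ := fun i => opSqrt ρ (onb (LatticeSpace K) i)
  have hψ : HasSum (fun i => ‖ψ i‖ ^ 2) 1 := hρ.hasSum_norm_sq_opSqrt
  rw [← tsum_absMoment_eq hρ.isPositive] at hX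
  set m := fun i => (absMoment (ψ i)).toReal
  have hm0 : ∀ i, 0 ≤ m i := fun i => ENNReal.toReal_nonneg
  have hm : Summable m := ENNReal.summable_toReal hX.ne
  have hmt : ∀ i, absMoment (ψ i) ≠ ⊤ := fun i => ENNReal.ne_top_of_tsum_ne_top hX.ne i
  set m' := ∑' i, m i
  have hm' : 0 ≤ m' := tsum_nonneg hm0
  obtain ⟨ν, hνfin, hν, hνchar⟩ := (hB.isBorelCalculus_velocity (ω := ω)).exists_measure_opCDF hρ
  -- One summand per error: variation of the projections, curvature of the bands, and the shift of
  -- f, where 1 + m' is the sum of ‖ψᵢ‖² + mᵢ.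
  set D : ℝ := S' + M + (1 + m')
  have hD : 0 ≤ D := by positivity
  have hC := mul_nonneg hD smoothingConst_nonneg
  refine ⟨2 + D * smoothingConst, by positivity, fun n hn => ?_⟩
  obtain ⟨μ, hμfin, hμ, hμchar⟩ := (isBorelCalculus_position W hn).exists_measure_opCDF hρ
  rw [hμ, hν]
  have hn0 : (0 : ℝ) < n := by positivity
  set ε : ℝ := (n : ℝ) ^ (-(1 / 3) : ℝ)
  have hε : 0 < ε := by positivity
  have hε1 : ε ≤ 1 := Real.rpow_le_one_of_one_le_of_nonpos (by exact_mod_cast hn) (by norm_num)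
  have hε3 : ε ^ 3 = (n : ℝ)⁻¹ := by
    rw [← Real.rpow_natCast, ← Real.rpow_mul hn0.le]
    norm_num
    rw [Real.rpow_neg_one]
  refine levyDist_le_of_charFun hε fun u => ?_
  -- Since 1/n = ε³, |s| = ε²|εu|, n s² = ε(εu)² and √|s| = ε√|εu|: each error carries at least one
  -- factor ε.
  set s : ℝ := u / n
  have hu : (n : ℝ) * s = u := by
    change (n : ℝ) * (u / n) = u
    field_simp
  have hs : |s| = ε ^ 2 * |ε * u| := by
    change |u / n| = _
    rw [abs_mul, abs_of_pos hε, abs_div, abs_of_pos hn0, div_eq_mul_inv, ← hε3]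
    ring
  have hpure : ∀ i, ‖inner ℂ (ψ i) (positionCalculus W n
        (fun t => Complex.exp (u * t * Complex.I)) (ψ i)) - inner ℂ (ψ i)
        (velocityCalculus ω Pr (fun t => Complex.exp (u * t * Complex.I)) (ψ i))‖ ≤
      ((S' * |s| + n * M * s ^ 2) * ‖ψ i‖ ^ 2) + √|s| * (‖ψ i‖ ^ 2 + m i) := by
    intro i
    have h1 := norm_inner_sub_inner_le hB hfib hband hω hM0 hM hPr hS0 hS hSP hn s (ψ i)
    rw [hu] at h1
    refine h1.trans ?_
    have h2 : ‖phaseOp s (ψ i) - ψ i‖ ^ 2 ≤ 2 * |s| * m i := norm_phaseOp_sub_sq_le s (hmt i)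
    -- The arithmetic–geometric mean inequality makes the bound linear in ‖ψᵢ‖² and mᵢ, both of
    -- which are summable over i.
    have h3 : ‖ψ i‖ * ‖phaseOp s (ψ i) - ψ i‖ ≤ √|s| * (‖ψ i‖ ^ 2 + m i) := by
      have hss : √|s| ^ 2 = |s| := Real.sq_sqrt (abs_nonneg s)
      refine le_of_sq_le_sq ?_ (by have := hm0 i; positivity)
      calc _ = ‖ψ i‖ ^ 2 * ‖phaseOp s (ψ i) - ψ i‖ ^ 2 := by ring
        _ ≤ ‖ψ i‖ ^ 2 * (2 * |s| * m i) := by gcongr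
        _ ≤ |s| * (‖ψ i‖ ^ 2 + m i) ^ 2 := by
          have : 0 ≤ |s| * ((‖ψ i‖ ^ 2) ^ 2 + m i ^ 2) := by positivity
          nlinarith
        _ = _ := by rw [mul_pow, hss]
    nlinarith
  have hsum := (hμchar u).sub (hνchar u)
  rw [← hsum.tsum_eq]
  refine (tsum_of_norm_bounded ((hψ.mul_left (S' * |s| + n * M * s ^ 2)).add
    ((hψ.add hm.hasSum).mul_left √|s|)) hpure).trans ?_
  have hsq : n * M * s ^ 2 = M * (ε * (ε * u) ^ 2) := by
    have : (n : ℝ) * s ^ 2 = u ^ 2 * (n : ℝ)⁻¹ := by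
      change (n : ℝ) * (u / n) ^ 2 = _
      field_simp
    calc _ = M * ((n : ℝ) * s ^ 2) := by ring
      _ = _ := by rw [this, ← hε3]; ring
  have hroot : √|s| = ε * √|ε * u| := by
    rw [hs, Real.sqrt_mul (by positivity), Real.sqrt_sq hε.le]
  rw [hsq, hroot, hs, mul_one]
  -- The projection error is smaller than needed; ε ≤ 1 brings it to the common order ε.
  have h1 : ε ^ 2 * |ε * u| ≤ ε * |ε * u| := by
    gcongr
    nlinarith
  have h2 : S' * (ε ^ 2 * |ε * u|) ≤ S' * (ε * |ε * u|) := by gcongr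
  set a := |ε * u|
  set b := (ε * u) ^ 2
  set c := √a
  have ha : 0 ≤ a := abs_nonneg _
  have hb : 0 ≤ b := sq_nonneg _
  have hc : 0 ≤ c := Real.sqrt_nonneg _
  calc _ ≤ ε * (S' * a + M * b + (1 + m') * c) := by
        change S' * (ε ^ 2 * a) + M * (ε * b) + ε * c * (1 + m') ≤ _
        nlinarith
    _ ≤ ε * (D * (a + b + c)) := by
        gcongr
        change _ ≤ (S' + M + (1 + m')) * (a + b + c)
        have := mul_nonneg hS' hb
        have := mul_nonneg hS' hc
        have := mul_nonneg hM0 ha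
        have := mul_nonneg hM0 hc
        have := mul_nonneg hm' ha
        have := mul_nonneg hm' hb
        nlinarith
    _ = _ := by ring
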